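/- Let $\mathbb{H}^2$ be the hyperbolic plane with distance $\delta(\cdot,\cdot)$, and let $\Gamma$ be a Fuchsian group, i.e. a group of orientation-preserving isometries of $\mathbb{H}^2$ no orbit of which has an accumulation point in $\mathbb{H}^2$. Let $P$ be a compact convex polygon in $\mathbb{H}^2$ with $N\ge 3$ vertices $v_1,\dots,v_N$ (angles equal to $\pi$ are allowed) which is a fundamental polygon for $\Gamma$ with sides paired by $\Gamma$: the images $\gamma P$, $\gamma\in\Gamma$, cover $\mathbb{H}^2$ and have pairwise disjoint interiors, and every side of $P$ is the image of some side of $P$ (possibly itself) under a nontrivial element of $\Gamma$. For points $[z],[w]$ of the compact quotient surface $S=\mathbb{H}^2/\Gamma$ let $$\delta^\star(z,w)=\inf_{\gamma_1,\gamma_2\in\Gamma}\delta(\gamma_1 z,\gamma_2 w)$$ be their distance on $S$. Let $T\subset\Gamma$ consist of the identity and all $\gamma\in\Gamma$ such that $\gamma P$ and $P$ share an edge or a vertex, and let $T^k$ be the set of all products of $k$ elements of $T$. Let $\delta$ be the least distance between two distinct non-adjacent sides of $P$ ($\delta=+\infty$ if there are none, i.e. $N=3$), let $\epsilon$ be the least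 distance from the midpoint of a side of $P$ to an adjacent side, and put $$k^\star=\left\lfloor 1+\frac{\max_{i,j}\delta(v_i,v_j)}{\min(\delta,2\epsilon)}\right\rfloor .$$ Then $\min(\delta,2\epsilon)>0$, the set $T^{k^\star}$ is finite, and for all $z,w\in P$ $$\delta^\star(z,w)=\min_{\gamma\in T^{k^\star}}\delta(z,\gamma w),$$ the minimum being attained. In particular, the least positive integer $k_{\min}$ such that $\delta^\star(z,w)=\min_{\gamma\in T^{k_{\min}}}\delta(z,\gamma w)$ for all $z,w\in P$ exists and satisfies $k_{\min}\le k^\star$. -/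

import Mathlib

open scoped UpperHalfPlane Pointwise MatrixGroups

noncomputable section

/-! The hyperbolic plane is Mathlib's upper half-plane `ℍ` with its hyperbolic distance `dist`,
and `ℍ ≃ᵢ ℍ` is its isometry group (composition as multiplication). -/

/-- The geodesic segment joining `x` and `y` in the hyperbolic plane. -/
def hypSegment (x y : ℍ) : Set ℍ := {p | dist x p + dist p y = dist x y}

/-- A set is (geodesically) convex if it contains the segment between any two of its points. -/
def HypConvex (C : Set ℍ) : Prop := ∀ x ∈ C, ∀ y ∈ C, hypSegment x y ⊆ C

/-- `m` is the midpoint of the geodesic segment joining `x` and `y`. -/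
def IsHypMidpoint (x y m : ℍ) : Prop := dist x m = dist x y / 2 ∧ dist m y = dist x y / 2

/-- A Fuchsian group: a group of orientation-preserving isometries of the hyperbolic plane
(Möbius transformations with real coefficients and determinant one) which acts discontinuously,
that is, no orbit has an accumulation point in the hyperbolic plane. -/
structure IsFuchsian (Γ : Subgroup (ℍ ≃ᵢ ℍ)) : Prop where
  orientation_preserving : ∀ γ ∈ Γ, ∃ g : SL(2, ℝ), ∀ z : ℍ, γ z = g • z
  discontinuous : ∀ z w : ℍ, ¬ AccPt w (Filter.principal {p : ℍ | ∃ γ ∈ Γ, p = γ z})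

/-- The distance `δ*` on the quotient surface `ℍ / Γ` between the classes of `z` and `w`: the
distance between the orbits `Γ z` and `Γ w`. -/
def surfaceDist (Γ : Subgroup (ℍ ≃ᵢ ℍ)) (z w : ℍ) : ℝ :=
  ⨅ p : Γ × Γ, dist ((p.1 : ℍ ≃ᵢ ℍ) z) ((p.2 : ℍ ≃ᵢ ℍ) w)

section Polygon

variable {N : ℕ} [NeZero N]

/-- The `i`-th side of the polygon with vertices `v 0, …, v (N - 1)` (cyclic indices; addition in
`Fin N` is modulo `N`). -/
def polySide (v : Fin N → ℍ) (i : Fin N) : Set ℍ := hypSegment (v i) (v (i + 1))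

/-- Two sides are adjacent if they follow each other in the cyclic order. -/
def AdjacentSides (i j : Fin N) : Prop := j = i + 1 ∨ i = j + 1

/-- Two sides are non-adjacent if they are distinct and have no common end. -/
def NonAdjacentSides (i j : Fin N) : Prop := i ≠ j ∧ ¬ AdjacentSides i j

/-- `P` is a compact convex hyperbolic polygon with vertices `v 0, …, v (N - 1)` in cyclic order:
a compact convex set with nonempty interior, whose boundary is the simple closed polygonal curve
through the vertices. As usual for fundamental polygons, an angle may be equal to `π`. -/
structure IsConvexPolygon (P : Set ℍ) (v : Fin N → ℍ) : Prop where
  three_le : 3 ≤ N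
  isCompact : IsCompact P
  convex : HypConvex P
  interior_nonempty : (interior P).Nonempty
  vertex_injective : Function.Injective v
  frontier_eq : frontier P = ⋃ i, polySide v i
  side_inter_succ : ∀ i, polySide v i ∩ polySide v (i + 1) = {v (i + 1)}
  side_disjoint : ∀ i j, NonAdjacentSides i j → Disjoint (polySide v i) (polySide v j)

/-- `P` is a convex compact fundamental polygon for `Γ`, whose sides are paired by `Γ`: the images
of `P` cover the plane, images under different elements have disjoint interiors, and every side is
the image of a side (possibly of itself) under a nontrivial element of `Γ`. -/
structure IsFundamentalPolygon (Γ : Subgroup (ℍ ≃ᵢ ℍ)) (P : Set ℍ) (v : Fin N → ℍ) : Prop where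
  polygon : IsConvexPolygon P v
  cover : ∀ z : ℍ, ∃ γ ∈ Γ, z ∈ γ '' P
  interior_disjoint : ∀ γ ∈ Γ, γ ≠ 1 → Disjoint (γ '' interior P) (interior P)
  side_pairing : ∀ i, ∃ j, ∃ γ ∈ Γ, γ ≠ 1 ∧ γ '' polySide v j = polySide v i

/-- The set `T`: the identity and all elements of `Γ` taking the polygon to an image with which it
shares an edge or a vertex. -/
def neighborMaps (Γ : Subgroup (ℍ ≃ᵢ ℍ)) (v : Fin N → ℍ) : Set (ℍ ≃ᵢ ℍ) :=
  {γ | γ ∈ Γ ∧ (γ = 1 ∨ (∃ i j, γ '' polySide v j = polySide v i) ∨ ∃ i j, γ (v j) = v i)}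

/-- `δ`: the least distance between two non-adjacent sides (`⊤` if there are no such sides, as for
a triangle). -/
def sideGap (v : Fin N → ℍ) : ENNReal :=
  ⨅ (i : Fin N) (j : Fin N) (_ : NonAdjacentSides i j) (p ∈ polySide v i) (q ∈ polySide v j),
    edist p q

/-- `ε`: the least distance from the midpoint of a side to an adjacent side. -/
def midpointGap (v : Fin N → ℍ) : ENNReal :=
  ⨅ (i : Fin N) (j : Fin N) (_ : AdjacentSides i j) (m : ℍ)
    (_ : IsHypMidpoint (v i) (v (i + 1)) m) (q ∈ polySide v j), edist m q

/-- `min (δ, 2 ε)` as a real number. -/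
def minGap (v : Fin N → ℍ) : ℝ := (min (sideGap v) (2 * midpointGap v)).toReal

/-- The largest distance between two vertices. -/
def maxVertexDist (v : Fin N → ℍ) : ℝ := ⨆ i, ⨆ j, dist (v i) (v j)

/-- `k* = ⌊1 + max δ(vᵢ, vⱼ) / min (δ, 2 ε)⌋`. -/
def kStar (v : Fin N → ℍ) : ℕ := ⌊1 + maxVertexDist v / minGap v⌋₊

/-- For all representatives `z, w ∈ P`, the surface distance is the (attained) minimum of
`dist z (γ w)` over `γ ∈ T ^ k`, where `T ^ k` is the set of all products of `k` elements
of `T`. -/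
def DistanceFormula (Γ : Subgroup (ℍ ≃ᵢ ℍ)) (P : Set ℍ) (v : Fin N → ℍ) (k : ℕ) : Prop :=
  ∀ z ∈ P, ∀ w ∈ P,
    IsLeast ((fun γ : ℍ ≃ᵢ ℍ => dist z (γ w)) '' (neighborMaps Γ v ^ k)) (surfaceDist Γ z w)

end Polygon

end

/-!
The theorem follows from one geometric fact (`HypTess.mem_neighborMaps_of_dist_lt`): if a point of
`P` and a point of `g P` are at distance less than `m = min (δ, 2 ε)`, then `g` belongs to `T`.
Indeed a shortest path from `z` to the orbit of `w` has length at most `max δ(vᵢ, vⱼ)`, because the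
diameter of `P` is attained at vertices. Cut it into `k*` pieces of length less than `m`;
consecutive cutting points lie in tiles which differ by an element of `T`, so the last tile is
given by an element of `T ^ k*`.

For the geometric fact, both points are first moved into general position, so that the geodesic
joining them passes through no vertex of the tessellation. It then crosses a finite sequence of
sides. Two consecutive ones are distinct sides of one tile; they are adjacent, since the path is
shorter than the distance of non-adjacent sides. If all consecutive pairs share the same vertex,
the last tile has this vertex in common with `P`. Otherwise some side `[u, u']` is crossed from a
side through `u` to a side through `u'`, and the path has length at least `m`
(`HypTess.minGap_le_of_corners`). The reason is that a point `p` of `[u, u']` has from the adjacent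
side at `u` a distance `d` with `sinh d ≥ κ sinh |u p|`, where
`κ = sinh (m / 2) / sinh (|u u'| / 2)` (`HypTess.sinh_mul_sinh_le_of_midpoints`), and that
`t ↦ arsinh (κ sinh t)` is convex (`HypTess.two_mul_le_add_of_sinh_le`).

The hyperbolic plane is treated in the hyperboloid model, where `cosh` of the distance is the
Lorentzian form, segments are traces of plane cones and lines are zero sets of determinants.
-/

namespace HypTess

open Real Set Filter Topology

/-! ### The hyperboloid model -/

/-- The point of the hyperboloid `a c - b² = 1`, `a > 0`, in `ℝ³` that corresponds to a point of
the upper half-plane. -/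
noncomputable def hvec (z : ℍ) : ℝ × ℝ × ℝ := (1 / z.im, z.re / z.im, (z.re ^ 2 + z.im ^ 2) / z.im)

/-- The polarization of the Lorentzian quadratic form `a c - b²` on `ℝ³`. -/
noncomputable def lor (p q : ℝ × ℝ × ℝ) : ℝ :=
  (p.1 * q.2.2 + q.1 * p.2.2) / 2 - p.2.1 * q.2.1

/-- The determinant of three vectors of `ℝ³`. -/
noncomputable def det3 (p q r : ℝ × ℝ × ℝ) : ℝ :=
  p.1 * (q.2.1 * r.2.2 - q.2.2 * r.2.1) - p.2.1 * (q.1 * r.2.2 - q.2.2 * r.1)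
    + p.2.2 * (q.1 * r.2.1 - q.2.1 * r.1)

lemma lor_comb_left (α β : ℝ) (p q r : ℝ × ℝ × ℝ) :
    lor (α • p + β • q) r = α * lor p r + β * lor q r := by
  simp only [lor, Prod.fst_add, Prod.snd_add, Prod.smul_fst, Prod.smul_snd, smul_eq_mul]; ring

lemma lor_smul_left (α : ℝ) (p r : ℝ × ℝ × ℝ) : lor (α • p) r = α * lor p r := by
  simp only [lor, Prod.smul_fst, Prod.smul_snd, smul_eq_mul]; ring

lemma lor_comm (p q : ℝ × ℝ × ℝ) : lor p q = lor q p := by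
  simp only [lor]; ring

lemma lor_comb_right (α β : ℝ) (p q r : ℝ × ℝ × ℝ) :
    lor r (α • p + β • q) = α * lor r p + β * lor r q := by
  rw [lor_comm, lor_comb_left, lor_comm p, lor_comm q]

lemma hvec_fst_pos (z : ℍ) : 0 < (hvec z).1 := one_div_pos.2 z.im_pos

lemma lor_hvec (z w : ℍ) : lor (hvec z) (hvec w) = cosh (dist z w) := by
  rw [UpperHalfPlane.cosh_dist']
  have hz := z.im_pos.ne'
  have hw := w.im_pos.ne'
  simp only [lor, hvec]
  field_simp
  ring

lemma lor_hvec_self (z : ℍ) : lor (hvec z) (hvec z) = 1 := by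
  rw [lor_hvec]; simp

lemma exists_hvec_eq {p : ℝ × ℝ × ℝ} (h : lor p p = 1) (hp : 0 < p.1) : ∃ z, hvec z = p := by
  obtain ⟨a, b, c⟩ := p
  simp only [lor] at h hp
  refine ⟨⟨⟨b / a, 1 / a⟩, one_div_pos.2 hp⟩, ?_⟩
  have ha := hp.ne'
  have hc : c = (1 + b ^ 2) / a := by field_simp; linarith
  simp only [hvec, UpperHalfPlane.re, UpperHalfPlane.im, hc]
  refine Prod.ext ?_ (Prod.ext ?_ ?_) <;> simp <;> field_simp
  ring

lemma eq_of_lor_eq_one {z w : ℍ} (h : lor (hvec z) (hvec w) = 1) : z = w := by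
  rw [lor_hvec] at h
  by_contra hne
  have : 0 < dist z w := dist_pos.2 hne
  have := one_lt_cosh.2 this.ne'
  linarith

lemma hvec_injective : Function.Injective hvec := fun z w h =>
  eq_of_lor_eq_one (by rw [h, lor_hvec_self])

/-- A vector on the two-sheeted hyperboloid pairing positively with one point of the upper sheet
lies on the upper sheet. -/
lemma exists_hvec_of_lor_pos {p : ℝ × ℝ × ℝ} (h : lor p p = 1) {z : ℍ} (hz : 0 < lor p (hvec z)) :
    ∃ w, hvec w = p := by
  rcases lt_trichotomy p.1 0 with hp | hp | hp
  · exfalso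
    obtain ⟨w, hw⟩ := exists_hvec_eq (p := (-1 : ℝ) • p)
      (by rw [lor_smul_left, lor_comm, lor_smul_left, h]; norm_num) (by simpa using hp)
    have h1 := lor_hvec w z
    rw [hw, lor_smul_left] at h1
    have := cosh_pos (dist w z)
    linarith
  · exfalso
    simp only [lor, hp] at h
    nlinarith [sq_nonneg p.2.1]
  · exact exists_hvec_eq h hp

lemma eq_hvec_of_lor_eq_one {p : ℝ × ℝ × ℝ} (h : lor p p = 1) {z : ℍ} (hz : lor p (hvec z) = 1) :
    p = hvec z := by
  obtain ⟨w, rfl⟩ := exists_hvec_of_lor_pos h (z := z) (by rw [hz]; exact one_pos)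
  rw [eq_of_lor_eq_one hz]

lemma continuous_hvec : Continuous hvec := by
  unfold hvec
  have h1 := UpperHalfPlane.continuous_re
  have h2 := UpperHalfPlane.continuous_im
  refine (continuous_const.div h2 fun z => z.im_pos.ne').prodMk
    ((h1.div h2 fun z => z.im_pos.ne').prodMk (((h1.pow 2).add (h2.pow 2)).div h2
      fun z => z.im_pos.ne'))

lemma continuous_det3 {X : Type*} [TopologicalSpace X] {f g h : X → ℝ × ℝ × ℝ} (hf : Continuous f)
    (hg : Continuous g) (hh : Continuous h) : Continuous fun x => det3 (f x) (g x) (h x) := by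
  unfold det3; fun_prop

/-- Gram's identity for the Lorentzian form. -/
lemma det3_sq (p q r : ℝ × ℝ × ℝ) :
    det3 p q r ^ 2 = 4 * (lor p p * (lor q q * lor r r - lor q r ^ 2)
      - lor p q * (lor p q * lor r r - lor q r * lor p r)
      + lor p r * (lor p q * lor q r - lor q q * lor p r)) := by
  simp only [det3, lor]; ring

/-! ### Geodesic lines and segments -/

lemma sinh_mul_cosh_add (s t : ℝ) :
    sinh s * cosh t + sinh t * cosh s = sinh (s + t) := by rw [sinh_add]; ring

lemma sinh_sq_add (s t : ℝ) :
    sinh s ^ 2 + sinh t ^ 2 + 2 * sinh s * sinh t * cosh (s + t) = sinh (s + t) ^ 2 := by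
  rw [sinh_add, cosh_add]
  have h1 := cosh_sq s
  have h2 := cosh_sq t
  linear_combination (-sinh t ^ 2) * h1 - (sinh s ^ 2) * h2

lemma lor_lineVec_self {x y : ℍ} (hxy : x ≠ y) (t : ℝ) :
    lor ((sinh (dist x y - t) / sinh (dist x y)) • hvec x + (sinh t / sinh (dist x y)) • hvec y)
      ((sinh (dist x y - t) / sinh (dist x y)) • hvec x + (sinh t / sinh (dist x y)) • hvec y)
      = 1 := by
  have hL : sinh (dist x y) ≠ 0 := (sinh_pos_iff.2 (dist_pos.2 hxy)).ne'
  have h := sinh_sq_add (dist x y - t) t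
  rw [sub_add_cancel] at h
  rw [lor_comb_left, lor_comb_right, lor_comb_right, lor_hvec_self, lor_hvec_self, lor_hvec,
    lor_hvec, dist_comm y x]
  field_simp
  linarith

lemma lor_lineVec_left {x y : ℍ} (hxy : x ≠ y) (t : ℝ) :
    lor ((sinh (dist x y - t) / sinh (dist x y)) • hvec x + (sinh t / sinh (dist x y)) • hvec y)
      (hvec x) = cosh t := by
  have hL : sinh (dist x y) ≠ 0 := (sinh_pos_iff.2 (dist_pos.2 hxy)).ne'
  rw [lor_comb_left, lor_hvec_self, lor_hvec, dist_comm y x]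
  field_simp
  rw [sinh_sub]
  ring

lemma lor_lineVec_lineVec {x y : ℍ} (hxy : x ≠ y) (s t : ℝ) :
    lor ((sinh (dist x y - s) / sinh (dist x y)) • hvec x + (sinh s / sinh (dist x y)) • hvec y)
      ((sinh (dist x y - t) / sinh (dist x y)) • hvec x + (sinh t / sinh (dist x y)) • hvec y)
      = cosh (s - t) := by
  have hL : sinh (dist x y) ≠ 0 := (sinh_pos_iff.2 (dist_pos.2 hxy)).ne'
  rw [lor_comb_left, lor_comb_right, lor_comb_right, lor_hvec_self, lor_hvec_self, lor_hvec,
    lor_hvec, dist_comm y x]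
  have h := cosh_sq (dist x y)
  field_simp
  rw [sinh_sub, sinh_sub, cosh_sub]
  linear_combination (-sinh s * sinh t) * h

/-- Through two distinct points passes a geodesic line parametrized by arc length. -/
lemma exists_line {x y : ℍ} (hxy : x ≠ y) :
    ∃ c : ℝ → ℍ, Isometry c ∧ c 0 = x ∧ c (dist x y) = y := by
  have hL : sinh (dist x y) ≠ 0 := (sinh_pos_iff.2 (dist_pos.2 hxy)).ne'
  have hex : ∀ t : ℝ, ∃ z : ℍ, hvec z = (sinh (dist x y - t) / sinh (dist x y)) • hvec x
      + (sinh t / sinh (dist x y)) • hvec y := fun t =>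
    exists_hvec_of_lor_pos (lor_lineVec_self hxy t) (z := x)
      (by rw [lor_lineVec_left hxy]; exact cosh_pos t)
  choose c hc using hex
  refine ⟨c, Isometry.of_dist_eq fun s t => ?_, hvec_injective ?_, hvec_injective ?_⟩
  · have h := lor_lineVec_lineVec hxy s t
    rw [← hc, ← hc, lor_hvec] at h
    rw [Real.dist_eq]
    rw [← cosh_abs (s - t)] at h
    exact cosh_injOn (mem_Ici.2 dist_nonneg) (mem_Ici.2 (abs_nonneg _)) h
  · rw [hc]; simp [hL]
  · rw [hc]; simp [hL]

lemma cosh_dist_line {c : ℝ → ℍ} (hc : Isometry c) (s t : ℝ) :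
    lor (hvec (c s)) (hvec (c t)) = cosh (s - t) := by
  rw [lor_hvec, hc.dist_eq, Real.dist_eq, cosh_abs]

/-- The points of a geodesic line are explicit linear combinations of any two of them. -/
lemma hvec_line {c : ℝ → ℍ} (hc : Isometry c) {a b : ℝ} (hab : a ≠ b) (t : ℝ) :
    hvec (c t) = (sinh (b - t) / sinh (b - a)) • hvec (c a)
      + (sinh (t - a) / sinh (b - a)) • hvec (c b) := by
  have hL : sinh (b - a) ≠ 0 := by
    rw [Ne, sinh_eq_zero]; exact sub_ne_zero.2 hab.symm
  symm
  apply eq_hvec_of_lor_eq_one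
  · rw [lor_comb_left, lor_comb_right, lor_comb_right, lor_hvec_self, lor_hvec_self,
      cosh_dist_line hc, cosh_dist_line hc, ← cosh_neg (a - b), neg_sub]
    have h := sinh_sq_add (b - t) (t - a)
    rw [sub_add_sub_cancel] at h
    field_simp
    linarith
  · rw [lor_comb_left, cosh_dist_line hc, cosh_dist_line hc, ← cosh_neg (a - t), neg_sub]
    have h := sinh_mul_cosh_add (b - t) (t - a)
    rw [sub_add_sub_cancel] at h
    field_simp
    linarith

/-- Three points with linearly dependent vectors lie on a line. -/
lemma exists_eq_line_of_det3_eq_zero {c : ℝ → ℍ} (hc : Isometry c) {a b : ℝ} (hab : a ≠ b) {q : ℍ}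
    (h : det3 (hvec (c a)) (hvec (c b)) (hvec q) = 0) : ∃ t, q = c t := by
  have hL : sinh (b - a) ≠ 0 := by
    rw [Ne, sinh_eq_zero]; exact sub_ne_zero.2 hab.symm
  have hg := det3_sq (hvec (c a)) (hvec (c b)) (hvec q)
  rw [h, lor_hvec_self, lor_hvec_self, lor_hvec_self, cosh_dist_line hc, ← cosh_neg, neg_sub,
    lor_hvec, lor_hvec] at hg
  set d := dist (c a) q
  set e := dist (c b) q
  -- Gram's identity says that `cosh e = cosh (b - a ± d)`, which determines the position of `q`
  have hprod : (cosh e - cosh (b - a - d)) * (cosh e - cosh (b - a + d)) = 0 := by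
    rw [cosh_sub, cosh_add]
    have h1 := cosh_sq (b - a)
    have h2 := cosh_sq d
    linear_combination (1/4) * hg + (cosh d ^ 2 - 1) * h1 + sinh (b - a) ^ 2 * h2
  have key : ∀ s : ℝ, cosh s = cosh d → cosh e = cosh (b - a - s) → q = c (a + s) := by
    intro s hs he
    apply Eq.symm
    apply eq_of_lor_eq_one
    rw [hvec_line hc hab, lor_comb_left, lor_hvec, lor_hvec]
    change _ * cosh d + _ * cosh e = 1
    rw [← hs, he]
    have h := sinh_mul_cosh_add (b - (a + s)) (a + s - a)
    rw [sub_add_sub_cancel] at h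
    have e1 : a + s - a = s := by ring
    have e2 : b - (a + s) = b - a - s := by ring
    rw [e1, e2] at h ⊢
    field_simp
    linarith
  rcases mul_eq_zero.1 hprod with h1 | h1
  · exact ⟨_, key d rfl (by linarith)⟩
  · refine ⟨_, key (-d) (cosh_neg d) ?_⟩
    rw [sub_neg_eq_add]; linarith

lemma det3_line_eq_zero {c : ℝ → ℍ} (hc : Isometry c) (r s t : ℝ) :
    det3 (hvec (c r)) (hvec (c s)) (hvec (c t)) = 0 := by
  rcases eq_or_ne r s with rfl | h
  · simp only [det3]; ring
  · rw [hvec_line hc h t]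
    simp only [det3, Prod.fst_add, Prod.snd_add, Prod.smul_fst, Prod.smul_snd, smul_eq_mul]; ring

/-- A line having two points in common with the line through `x` and `y` passes through `x` and
`y`. -/
lemma exists_line_eq_of_det3_eq_zero {c : ℝ → ℍ} (hc : Isometry c) {x y : ℍ} (hxy : x ≠ y) {a b : ℝ}
    (hab : a ≠ b) (ha : det3 (hvec x) (hvec y) (hvec (c a)) = 0)
    (hb : det3 (hvec x) (hvec y) (hvec (c b)) = 0) : ∃ t, x = c t := by
  obtain ⟨c', hc', rfl, hy⟩ := exists_line hxy
  have hL : (0 : ℝ) ≠ dist (c' 0) y := (dist_pos.2 hxy).ne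
  set L := dist (c' 0) y
  rw [← hy] at ha hb
  obtain ⟨s, hs⟩ := exists_eq_line_of_det3_eq_zero hc' hL ha
  obtain ⟨t, ht⟩ := exists_eq_line_of_det3_eq_zero hc' hL hb
  apply exists_eq_line_of_det3_eq_zero hc hab
  rw [hs, ht, det3_line_eq_zero hc']

lemma mem_hypSegment_line {c : ℝ → ℍ} (hc : Isometry c) {a b t : ℝ} (h1 : a ≤ t) (h2 : t ≤ b) :
    c t ∈ hypSegment (c a) (c b) := by
  simp only [hypSegment, mem_ofPred_eq, hc.dist_eq, Real.dist_eq]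
  rw [abs_of_nonpos (by linarith), abs_of_nonpos (by linarith), abs_of_nonpos (by linarith)]
  ring

/-- A point of a segment lies on the line carrying the segment. -/
lemma eq_line_of_mem_hypSegment {c : ℝ → ℍ} (hc : Isometry c) {a b : ℝ} (hab : a < b) {p : ℍ}
    (hp : p ∈ hypSegment (c a) (c b)) : p = c (a + dist (c a) p) := by
  have hL : sinh (b - a) ≠ 0 := by
    rw [Ne, sinh_eq_zero]; exact sub_ne_zero.2 hab.ne'
  simp only [hypSegment, mem_ofPred_eq, hc.dist_eq a b, Real.dist_eq] at hp
  rw [abs_of_nonpos (by linarith)] at hp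
  apply Eq.symm
  apply eq_of_lor_eq_one
  rw [hvec_line hc hab.ne, lor_comb_left, lor_hvec, lor_hvec, dist_comm (c b) p]
  have e1 : a + dist (c a) p - a = dist (c a) p := by ring
  have e2 : b - (a + dist (c a) p) = dist p (c b) := by linarith
  have h := sinh_mul_cosh_add (dist p (c b)) (dist (c a) p)
  rw [show dist p (c b) + dist (c a) p = b - a by linarith] at h
  rw [e1, e2]
  field_simp
  linarith

lemma left_mem_hypSegment (x y : ℍ) : x ∈ hypSegment x y := by simp [hypSegment]

lemma right_mem_hypSegment (x y : ℍ) : y ∈ hypSegment x y := by simp [hypSegment]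

lemma image_hypSegment (g : ℍ ≃ᵢ ℍ) (x y : ℍ) :
    g '' hypSegment x y = hypSegment (g x) (g y) := by
  ext p
  constructor
  · rintro ⟨q, hq, rfl⟩
    simpa [hypSegment, g.isometry.dist_eq] using hq
  · intro hp
    refine ⟨g.symm p, ?_, g.apply_symm_apply p⟩
    have h1 := g.isometry.dist_eq x (g.symm p)
    have h2 := g.isometry.dist_eq (g.symm p) y
    rw [g.apply_symm_apply] at h1 h2
    simp only [hypSegment, mem_ofPred_eq] at hp ⊢
    rw [← h1, ← h2, hp, g.isometry.dist_eq]

lemma hypSegment_comm (x y : ℍ) : hypSegment x y = hypSegment y x := by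
  ext p
  simp only [hypSegment, mem_ofPred_eq, dist_comm y p, dist_comm p x, dist_comm y x]
  rw [add_comm]

lemma dist_le_of_mem_hypSegment {x y p q : ℍ} (hp : p ∈ hypSegment x y) (hq : q ∈ hypSegment x y) :
    dist p q ≤ dist x y := by
  simp only [hypSegment, mem_ofPred_eq] at hp hq
  have h1 := dist_triangle p x q
  have h2 := dist_triangle p y q
  rw [dist_comm p x] at h1
  rw [dist_comm y q] at h2
  linarith

/-- A segment determines its two ends. -/
lemma eq_or_eq_of_hypSegment_eq {x y x' y' : ℍ} (h : hypSegment x y = hypSegment x' y') :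
    x = x' ∧ y = y' ∨ x = y' ∧ y = x' := by
  have hx' : x' ∈ hypSegment x y := h ▸ left_mem_hypSegment x' y'
  have hy' : y' ∈ hypSegment x y := h ▸ right_mem_hypSegment x' y'
  have hd : dist x y = dist x' y' := le_antisymm
    (dist_le_of_mem_hypSegment (h ▸ left_mem_hypSegment x y) (h ▸ right_mem_hypSegment x y))
    (dist_le_of_mem_hypSegment hx' hy')
  simp only [hypSegment, mem_ofPred_eq] at hx' hy'
  rcases eq_or_ne x y with rfl | hne
  · rw [dist_self] at hd hx' hy'
    have e1 : dist x x' = 0 := by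
      linarith [dist_nonneg (x := x) (y := x'), dist_nonneg (x := x') (y := x)]
    have e2 : dist x y' = 0 := by
      linarith [dist_nonneg (x := x) (y := y'), dist_nonneg (x := y') (y := x)]
    exact Or.inl ⟨dist_eq_zero.1 e1, dist_eq_zero.1 e2⟩
  obtain ⟨c, hc, rfl, hy⟩ := exists_line hne
  have hL := dist_pos.2 hne
  set L := dist (c 0) y
  have e1 := eq_line_of_mem_hypSegment hc hL (p := x') (by rw [hy]; exact hx')
  have e2 := eq_line_of_mem_hypSegment hc hL (p := y') (by rw [hy]; exact hy')
  rw [zero_add] at e1 e2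
  set s := dist (c 0) x'
  set t := dist (c 0) y'
  rw [e1, e2, hc.dist_eq, Real.dist_eq] at hd
  have hs : s ≤ L := by linarith [dist_nonneg (x := x') (y := y)]
  have ht : t ≤ L := by linarith [dist_nonneg (x := y') (y := y)]
  have hs0 : 0 ≤ s := dist_nonneg
  have ht0 : 0 ≤ t := dist_nonneg
  rcases le_total s t with hst | hst
  · rw [abs_of_nonpos (by linarith)] at hd
    left
    have hs' : s = 0 := by linarith
    have ht' : t = L := by linarith
    rw [hs'] at e1
    rw [ht', hy] at e2
    exact ⟨e1.symm, e2.symm⟩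
  · rw [abs_of_nonneg (by linarith)] at hd
    right
    have ht' : t = 0 := by linarith
    have hs' : s = L := by linarith
    rw [hs', hy] at e1
    rw [ht'] at e2
    exact ⟨e2.symm, e1.symm⟩

lemma exists_isHypMidpoint (x y : ℍ) : ∃ m, IsHypMidpoint x y m := by
  rcases eq_or_ne x y with rfl | hne
  · exact ⟨x, by simp [IsHypMidpoint]⟩
  obtain ⟨c, hc, rfl, hy⟩ := exists_line hne
  have hL := dist_pos.2 hne
  set L := dist (c 0) y with hLdef
  refine ⟨c (L / 2), ?_, ?_⟩
  · rw [← hLdef, hc.dist_eq, Real.dist_eq, abs_of_nonpos (by linarith)]; ring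
  · rw [← hLdef, ← hy, hc.dist_eq, Real.dist_eq, abs_of_nonpos (by linarith)]; ring

/-! ### Distances between two sides with a common end -/

/-- The hyperbolic law of cosines; `C` is the cosine of the angle at `u`. -/
lemma exists_cosh_dist_eq {u x y : ℍ} (hx : u ≠ x) (hy : u ≠ y) :
    ∃ C : ℝ, |C| ≤ 1 ∧ ∀ p ∈ hypSegment u x, ∀ q ∈ hypSegment u y,
      cosh (dist p q) = cosh (dist u p) * cosh (dist u q) - C * (sinh (dist u p) * sinh (dist u q))
      := by
  obtain ⟨c, hc, hc0, hcx⟩ := exists_line hx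
  obtain ⟨c', hc', hc0', hcy⟩ := exists_line hy
  have ha := dist_pos.2 hx
  have hb := dist_pos.2 hy
  have hsa := sinh_pos_iff.2 ha
  have hsb := sinh_pos_iff.2 hb
  refine ⟨(cosh (dist u x) * cosh (dist u y) - cosh (dist x y)) /
    (sinh (dist u x) * sinh (dist u y)), ?_, ?_⟩
  · rw [abs_le, le_div_iff₀ (mul_pos hsa hsb), div_le_one (mul_pos hsa hsb)]
    have h1 : cosh (dist x y) ≤ cosh (dist u x + dist u y) := by
      rw [cosh_le_cosh, abs_of_nonneg dist_nonneg, abs_of_nonneg (by positivity), dist_comm u x]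
      exact dist_triangle _ _ _
    have h2 : cosh (dist u x - dist u y) ≤ cosh (dist x y) := by
      rw [cosh_le_cosh, abs_of_nonneg (dist_nonneg (x := x)), dist_comm u x, dist_comm u y]
      exact abs_dist_sub_le _ _ _
    rw [cosh_add] at h1
    rw [cosh_sub] at h2
    constructor <;> linarith
  · intro p hp q hq
    have ep := eq_line_of_mem_hypSegment hc ha (p := p) (by rw [hc0, hcx]; exact hp)
    have eq := eq_line_of_mem_hypSegment hc' hb (p := q) (by rw [hc0', hcy]; exact hq)
    rw [zero_add, hc0] at ep
    rw [zero_add, hc0'] at eq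
    rw [← lor_hvec p q]
    have vp := hvec_line hc ha.ne (dist u p)
    have vq := hvec_line hc' hb.ne (dist u q)
    rw [← ep, hc0, hcx] at vp
    rw [← eq, hc0', hcy] at vq
    rw [vp, vq, lor_comb_left, lor_comb_right, lor_comb_right, lor_hvec_self, lor_hvec, lor_hvec,
      lor_hvec, dist_comm x u]
    simp only [sub_zero]
    rw [sinh_sub, sinh_sub]
    field_simp
    ring

lemma exists_mem_hypSegment {x y : ℍ} {s : ℝ} (h0 : 0 ≤ s) (h1 : s ≤ dist x y) :
    ∃ p ∈ hypSegment x y, dist x p = s := by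
  rcases eq_or_ne x y with rfl | hne
  · refine ⟨x, left_mem_hypSegment _ _, ?_⟩
    rw [dist_self] at h1 ⊢
    linarith
  obtain ⟨c, hc, hx, hy⟩ := exists_line hne
  refine ⟨c s, ?_, ?_⟩
  · have := mem_hypSegment_line hc h0 h1
    rwa [hx, hy] at this
  · rw [← hx, hc.dist_eq, Real.dist_eq, zero_sub, abs_neg, abs_of_nonneg h0]

/-- The foot of the perpendicular dropped from a point at distance `h` from the vertex of an acute
angle is at distance at most `h` from the vertex. -/
lemma exists_foot {C h : ℝ} (hC0 : 0 ≤ C) (hC1 : C ≤ 1) (hh : 0 ≤ h) :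
    ∃ s, 0 ≤ s ∧ s ≤ h ∧ cosh h * sinh s = C * (sinh h * cosh s) := by
  have hcont : ContinuousOn (fun s => cosh h * sinh s - C * (sinh h * cosh s)) (Icc 0 h) := by
    fun_prop
  have hsh : 0 ≤ sinh h := sinh_nonneg_iff.2 hh
  have hch := cosh_pos h
  obtain ⟨s, hs, hs'⟩ := intermediate_value_Icc hh hcont (show (0 : ℝ) ∈ Icc _ _ by
    constructor
    · simp; positivity
    · have : 0 ≤ (1 - C) * (sinh h * cosh h) := mul_nonneg (by linarith) (by positivity)
      linarith)
  exact ⟨s, hs.1, hs.2, by simpa [sub_eq_zero] using hs'⟩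

/-- Pythagoras' theorem for the perpendicular from one leg of an angle to the other: here
`(1 - C ^ 2) * sinh t ^ 2` is the square of the hyperbolic sine of the distance to the line, and
the last square measures the deviation from the foot. -/
lemma sinh_sq_of_cosh_eq {C d s t : ℝ} (h : cosh d = cosh t * cosh s - C * (sinh t * sinh s)) :
    sinh d ^ 2 = (1 - C ^ 2) * sinh t ^ 2 + (cosh t * sinh s - C * (sinh t * cosh s)) ^ 2 := by
  have h1 := cosh_sq d
  have h2 := cosh_sq t
  have h3 := cosh_sq s
  rw [h] at h1
  linear_combination (-1) * h1 + (1 + sinh s ^ 2) * h2 + (cosh t ^ 2) * h3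
    - (sinh s ^ 2) * h2 - C ^ 2 * sinh t ^ 2 * h3

/-- If the midpoint of each of two segments `[u, u']`, `[u, x]` is at distance at least `μ` from
the other one, then a point `p` of `[u, u']` at distance `t` from `u` is at a distance `d` from
`[u, x]` with `sinh d ≥ sinh μ * sinh t / sinh (|u u'| / 2)`. This holds because the angle at `u`
is obtuse, or because the perpendicular from the midpoint of one of the segments has its foot on
the other segment. -/
lemma sinh_mul_sinh_le_of_midpoints {u u' x : ℍ} (hu' : u ≠ u') (hx : u ≠ x) {μ : ℝ} (hμ : 0 ≤ μ)
    (h1 : ∀ m, IsHypMidpoint u u' m → ∀ q ∈ hypSegment u x, μ ≤ dist m q)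
    (h2 : ∀ m, IsHypMidpoint u x m → ∀ q ∈ hypSegment u u', μ ≤ dist m q)
    {p q : ℍ} (hp : p ∈ hypSegment u u') (hq : q ∈ hypSegment u x) :
    sinh μ * sinh (dist u p) ≤ sinh (dist p q) * sinh (dist u u' / 2) := by
  obtain ⟨C, hC, hcos⟩ := exists_cosh_dist_eq hu' hx
  rw [abs_le] at hC
  obtain ⟨m, hm⟩ := exists_isHypMidpoint u u'
  obtain ⟨m', hm'⟩ := exists_isHypMidpoint u x
  have hmS : m ∈ hypSegment u u' := by
    simp only [hypSegment, mem_ofPred_eq, hm.1, hm.2]; ring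
  have hmS' : m' ∈ hypSegment u x := by
    simp only [hypSegment, mem_ofPred_eq, hm'.1, hm'.2]; ring
  have hl := dist_pos.2 hu'
  have ha := dist_pos.2 hx
  have hshμ : 0 ≤ sinh μ := sinh_nonneg_iff.2 hμ
  have hsht : 0 ≤ sinh (dist u p) := sinh_nonneg_iff.2 dist_nonneg
  have hshd : 0 ≤ sinh (dist p q) := sinh_nonneg_iff.2 dist_nonneg
  have hshl : 0 ≤ sinh (dist u u' / 2) := sinh_nonneg_iff.2 (by positivity)
  have hpq := sinh_sq_of_cosh_eq (hcos p hp q hq)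
  have hshs : 0 ≤ sinh (dist u q) := sinh_nonneg_iff.2 dist_nonneg
  rcases le_total C 0 with hC0 | hC0
  · have e1 : sinh (dist u p) ≤ sinh (dist p q) := by
      rw [← sq_le_sq₀ hsht hshd, hpq]
      have c1 := one_le_cosh (dist u q)
      have c2 := cosh_pos (dist u p)
      have : (-C * sinh (dist u p)) ^ 2 ≤ (cosh (dist u p) * sinh (dist u q)
          - C * (sinh (dist u p) * cosh (dist u q))) ^ 2 := by
        apply pow_le_pow_left₀ (mul_nonneg (by linarith) hsht)
        have i1 : 0 ≤ cosh (dist u p) * sinh (dist u q) := by positivity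
        have i2 : 0 ≤ -C * sinh (dist u p) * (cosh (dist u q) - 1) :=
          mul_nonneg (mul_nonneg (by linarith) hsht) (by linarith)
        linarith
      linarith
    have e2 : sinh μ ≤ sinh (dist u u' / 2) := by
      rw [sinh_le_sinh, ← hm.1, dist_comm]
      exact h1 m hm u (left_mem_hypSegment _ _)
    calc sinh μ * sinh (dist u p) ≤ sinh (dist u u' / 2) * sinh (dist p q) := by gcongr
      _ = _ := mul_comm _ _
  · -- The sine of the angle is at least `sinh μ / sinh (dist u u' / 2)`: drop a perpendicular
    -- from `m` if `[u, x]` is long enough to contain its foot, and from `m'` otherwise.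
    have key : sinh μ ^ 2 ≤ (1 - C ^ 2) * sinh (dist u u' / 2) ^ 2 := by
      have hC2 : 0 ≤ 1 - C ^ 2 := by nlinarith
      rcases le_total (dist u u' / 2) (dist u x) with hcase | hcase
      · obtain ⟨s, hs0, hs1, hs⟩ := exists_foot hC0 hC.2 (h := dist u u' / 2) (by positivity)
        obtain ⟨r, hr, hrs⟩ := exists_mem_hypSegment hs0 (hs1.trans hcase)
        have e := sinh_sq_of_cosh_eq (hcos m hmS r hr)
        rw [hm.1, hrs, hs, sub_self] at e
        have e' : sinh μ ≤ sinh (dist m r) := sinh_le_sinh.2 (h1 m hm r hr)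
        have := pow_le_pow_left₀ hshμ e' 2
        linarith
      · obtain ⟨s, hs0, hs1, hs⟩ := exists_foot hC0 hC.2 (h := dist u x / 2) (by positivity)
        obtain ⟨r, hr, hrs⟩ := exists_mem_hypSegment (x := u) (y := u') hs0 (by linarith)
        have e0 := hcos r hr m' hmS'
        rw [mul_comm (cosh _), mul_comm (sinh _)] at e0
        have e := sinh_sq_of_cosh_eq e0
        rw [hm'.1, hrs, hs, sub_self] at e
        have e' : sinh μ ≤ sinh (dist r m') := by
          rw [sinh_le_sinh, dist_comm]; exact h2 m' hm' r hr
        have h3 := pow_le_pow_left₀ hshμ e' 2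
        have h4 : sinh (dist u x / 2) ^ 2 ≤ sinh (dist u u' / 2) ^ 2 :=
          pow_le_pow_left₀ (sinh_nonneg_iff.2 (by positivity)) (sinh_le_sinh.2 (by linarith)) 2
        have := mul_le_mul_of_nonneg_left h4 hC2
        linarith
    rw [← sq_le_sq₀ (by positivity) (by positivity), mul_pow, mul_pow]
    calc sinh μ ^ 2 * sinh (dist u p) ^ 2
        ≤ (1 - C ^ 2) * sinh (dist u u' / 2) ^ 2 * sinh (dist u p) ^ 2 := by gcongr
      _ = ((1 - C ^ 2) * sinh (dist u p) ^ 2) * sinh (dist u u' / 2) ^ 2 := by ring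
      _ ≤ sinh (dist p q) ^ 2 * sinh (dist u u' / 2) ^ 2 := by
        gcongr
        rw [hpq]
        linarith [sq_nonneg (cosh (dist u p) * sinh (dist u q)
          - C * (sinh (dist u p) * cosh (dist u q)))]

/-- For `0 ≤ κ ≤ 1` the function `t ↦ arsinh (κ sinh t)` is `1`-Lipschitz. -/
lemma arsinh_mul_sinh_sub_le {κ : ℝ} (h0 : 0 ≤ κ) (h1 : κ ≤ 1) {s t : ℝ} (hst : s ≤ t) :
    arsinh (κ * sinh t) - arsinh (κ * sinh s) ≤ t - s := by
  set H := arsinh (κ * sinh s) with hH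
  have hs : sinh H = κ * sinh s := sinh_arsinh _
  have hc : κ * cosh s ≤ cosh H := by
    rw [← sq_le_sq₀ (mul_nonneg h0 (cosh_pos s).le) (cosh_pos H).le, cosh_sq H, hs, mul_pow,
      cosh_sq s]
    nlinarith
  have : arsinh (κ * sinh t) ≤ H + (t - s) := by
    rw [← sinh_le_sinh, sinh_arsinh, sinh_add, hs]
    have e : sinh t = sinh s * cosh (t - s) + cosh s * sinh (t - s) := by
      rw [← sinh_add, add_sub_cancel]
    have hd : 0 ≤ sinh (t - s) := sinh_nonneg_iff.2 (by linarith)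
    rw [e]
    have := mul_le_mul_of_nonneg_right hc hd
    linarith
  linarith

/-- The convexity inequality `H t + H (l - t) ≥ 2 H (l / 2)` for `H t = arsinh (κ sinh t)`, where
`κ = sinh μ / sinh (l / 2)`. -/
lemma two_mul_le_add_of_sinh_le {μ l t d₁ d₂ : ℝ} (hμ : 0 ≤ μ) (hμl : μ ≤ l / 2) (hl : 0 < l)
    (h1 : sinh μ * sinh t ≤ sinh d₁ * sinh (l / 2))
    (h2 : sinh μ * sinh (l - t) ≤ sinh d₂ * sinh (l / 2)) : 2 * μ ≤ d₁ + d₂ := by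
  have hS : 0 < sinh (l / 2) := sinh_pos_iff.2 (by positivity)
  set κ := sinh μ / sinh (l / 2) with hκ
  have hκ0 : 0 ≤ κ := div_nonneg (sinh_nonneg_iff.2 hμ) hS.le
  have hκ1 : κ ≤ 1 := (div_le_one hS).2 (sinh_le_sinh.2 hμl)
  have e1 : arsinh (κ * sinh t) ≤ d₁ := by
    rw [← sinh_le_sinh, sinh_arsinh, hκ, div_mul_eq_mul_div, div_le_iff₀ hS]; exact h1
  have e2 : arsinh (κ * sinh (l - t)) ≤ d₂ := by
    rw [← sinh_le_sinh, sinh_arsinh, hκ, div_mul_eq_mul_div, div_le_iff₀ hS]; exact h2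
  set A := arsinh (κ * sinh t) with hA
  set B := arsinh (κ * sinh (l - t)) with hB
  suffices μ ≤ (A + B) / 2 by linarith
  rw [← sinh_le_sinh]
  have hAB : |(A - B) / 2| ≤ |(t - (l - t)) / 2| := by
    rw [abs_div, abs_div]
    refine div_le_div_of_nonneg_right ?_ (abs_nonneg 2)
    rcases le_total t (l - t) with h | h
    · have hle := arsinh_mul_sinh_sub_le hκ0 hκ1 h
      have hm : A ≤ B := arsinh_le_arsinh.2 (mul_le_mul_of_nonneg_left (sinh_le_sinh.2 h) hκ0)
      rw [abs_of_nonpos (by linarith), abs_of_nonpos (by linarith)]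
      linarith
    · have hle := arsinh_mul_sinh_sub_le hκ0 hκ1 h
      have hm : B ≤ A := arsinh_le_arsinh.2 (mul_le_mul_of_nonneg_left (sinh_le_sinh.2 h) hκ0)
      rw [abs_of_nonneg (by linarith), abs_of_nonneg (by linarith)]
      linarith
  have hcosh : cosh ((A - B) / 2) ≤ cosh ((t - (l - t)) / 2) := cosh_le_cosh.2 hAB
  have hsum : ∀ x y : ℝ, sinh x + sinh y = 2 * sinh ((x + y) / 2) * cosh ((x - y) / 2) := by
    intro x y
    have h := sinh_add ((x + y) / 2) ((x - y) / 2)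
    have h' := sinh_sub ((x + y) / 2) ((x - y) / 2)
    rw [show (x + y) / 2 + (x - y) / 2 = x by ring] at h
    rw [show (x + y) / 2 - (x - y) / 2 = y by ring] at h'
    rw [h, h']
    ring
  have hs1 := hsum A B
  have hs2 := hsum t (l - t)
  rw [hA, hB, sinh_arsinh, sinh_arsinh, ← hA, ← hB, ← mul_add, hs2, add_sub_cancel] at hs1
  have hκS : κ * sinh (l / 2) = sinh μ := div_mul_cancel₀ _ hS.ne'
  have hcp := cosh_pos ((A - B) / 2)
  have h3 : sinh μ * cosh ((A - B) / 2) ≤ sinh ((A + B) / 2) * cosh ((A - B) / 2) := by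
    have := mul_le_mul_of_nonneg_left hcosh (sinh_nonneg_iff.2 hμ)
    rw [← hκS] at this ⊢
    linarith
  exact le_of_mul_le_mul_right h3 hcp

/-! ### Convex sets in the hyperboloid model -/

/-- Segments of the hyperbolic plane are the traces of two-dimensional convex cones. -/
lemma mem_hypSegment_of_comb {x y q : ℍ} {α β : ℝ} (hα : 0 ≤ α) (hβ : 0 ≤ β)
    (hq : hvec q = α • hvec x + β • hvec y) : q ∈ hypSegment x y := by
  have h1 := lor_hvec_self q
  rw [hq, lor_comb_left, lor_comb_right, lor_comb_right, lor_hvec_self, lor_hvec_self, lor_hvec,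
    lor_hvec, dist_comm y x] at h1
  rcases eq_or_ne x y with rfl | hxy
  · have : α + β = 1 := by
      rw [dist_self, cosh_zero] at h1
      nlinarith
    rw [← add_smul, this, one_smul] at hq
    rw [hvec_injective hq]
    exact left_mem_hypSegment _ _
  obtain ⟨c, hc, hx, hy⟩ := exists_line hxy
  have hL := dist_pos.2 hxy
  have hS := sinh_pos_iff.2 hL
  set L := dist x y with hLdef
  set t := arsinh (β * sinh L) with ht
  have hst : sinh t = β * sinh L := sinh_arsinh _
  have hct : cosh t = α + β * cosh L := by
    rw [← abs_of_pos (cosh_pos t), ← abs_of_nonneg (a := α + β * cosh L)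
      (add_nonneg hα (mul_nonneg hβ (cosh_pos L).le)), ← sq_eq_sq_iff_abs_eq_abs, cosh_sq, hst]
    linear_combination (-1) * h1 - β ^ 2 * cosh_sq L
  have hst' : sinh (L - t) = α * sinh L := by
    rw [sinh_sub, hst, hct]; ring
  have ht0 : 0 ≤ t := by rw [← sinh_nonneg_iff, hst]; positivity
  have htL : t ≤ L := by
    have : 0 ≤ L - t := by rw [← sinh_nonneg_iff, hst']; positivity
    linarith
  have hv := hvec_line hc hL.ne t
  rw [sub_zero, sub_zero, hst, hst', hx, hy, mul_div_cancel_right₀ _ hS.ne',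
    mul_div_cancel_right₀ _ hS.ne', ← hq] at hv
  rw [← hvec_injective hv, ← hx, ← hy]
  exact mem_hypSegment_line hc ht0 htL

/-- The cone over a convex set is closed under nonnegative linear combinations. -/
lemma _root_.HypConvex.mem_of_comb {C : Set ℍ} (hC : HypConvex C) {x y z q : ℍ} (hx : x ∈ C)
    (hy : y ∈ C) (hz : z ∈ C) {α β γ : ℝ} (hα : 0 ≤ α) (hβ : 0 ≤ β) (hγ : 0 ≤ γ)
    (hq : hvec q = α • hvec x + β • hvec y + γ • hvec z) : q ∈ C := by
  by_cases h0 : α = 0 ∧ β = 0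
  · rw [h0.1, h0.2] at hq
    apply hC z hz z hz
    apply mem_hypSegment_of_comb (α := 0) le_rfl hγ
    rw [hq]; simp
  set w := α • hvec x + β • hvec y with hw
  have hww : 0 < lor w w := by
    rw [hw, lor_comb_left, lor_comb_right, lor_comb_right, lor_hvec_self, lor_hvec_self, lor_hvec,
      lor_hvec, dist_comm y x]
    have hc := cosh_pos (dist x y)
    rcases hα.eq_or_lt with h | h
    · have : 0 < β := hβ.lt_of_ne fun hb => h0 ⟨h.symm, hb.symm⟩
      subst h
      nlinarith
    · have i1 : 0 < α * α := by positivity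
      have i2 : 0 ≤ β * β := by positivity
      have i3 : 0 ≤ α * β * cosh (dist x y) := by positivity
      nlinarith
  set n := √(lor w w)
  have hn : 0 < n := sqrt_pos.2 hww
  have hnn : n * n = lor w w := mul_self_sqrt hww.le
  obtain ⟨r, hr⟩ := exists_hvec_of_lor_pos (p := n⁻¹ • w) (z := x)
    (by rw [lor_smul_left, lor_comm, lor_smul_left, ← hnn]; field_simp)
    (by
      rw [lor_smul_left, hw, lor_comb_left, lor_hvec_self, lor_hvec]
      have hc := cosh_pos (dist y x)
      refine mul_pos (inv_pos.2 hn) ?_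
      rcases hα.eq_or_lt with h | h
      · have : 0 < β := hβ.lt_of_ne fun hb => h0 ⟨h.symm, hb.symm⟩
        rw [← h]; positivity
      · positivity)
  have hrC : r ∈ C := by
    refine hC x hx y hy (mem_hypSegment_of_comb (α := n⁻¹ * α) (β := n⁻¹ * β) (by positivity)
      (by positivity) ?_)
    rw [hr, hw, smul_add, smul_smul, smul_smul]
  refine hC r hrC z hz (mem_hypSegment_of_comb hn.le hγ ?_)
  rw [hq, hr, smul_smul, mul_inv_cancel₀ hn.ne', one_smul]

/-- Cramer's rule. -/
lemma hvec_eq_comb_of_det3_ne_zero {x y z : ℝ × ℝ × ℝ} (h : det3 x y z ≠ 0) (q : ℝ × ℝ × ℝ) :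
    q = (det3 q y z / det3 x y z) • x + (det3 x q z / det3 x y z) • y
      + (det3 x y q / det3 x y z) • z := by
  refine Prod.ext ?_ (Prod.ext ?_ ?_) <;>
  · simp only [Prod.fst_add, Prod.snd_add, Prod.smul_fst, Prod.smul_snd, smul_eq_mul]
    rw [div_mul_eq_mul_div, div_mul_eq_mul_div, div_mul_eq_mul_div, ← add_div, ← add_div,
      eq_div_iff h]
    simp only [det3]
    ring

/-- The points with positive coordinates with respect to `x`, `y`, `z` form the open triangle with
these vertices. -/
lemma _root_.HypConvex.mem_interior_of_det3_pos {C : Set ℍ} (hC : HypConvex C) {x y z q : ℍ}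
    (hx : x ∈ C) (hy : y ∈ C) (hz : z ∈ C) (h : det3 (hvec x) (hvec y) (hvec z) ≠ 0)
    (h1 : 0 < det3 (hvec q) (hvec y) (hvec z) / det3 (hvec x) (hvec y) (hvec z))
    (h2 : 0 < det3 (hvec x) (hvec q) (hvec z) / det3 (hvec x) (hvec y) (hvec z))
    (h3 : 0 < det3 (hvec x) (hvec y) (hvec q) / det3 (hvec x) (hvec y) (hvec z)) :
    q ∈ interior C := by
  have c1 := (continuous_det3 continuous_hvec (continuous_const (y := hvec y))
    (continuous_const (y := hvec z))).div_const (det3 (hvec x) (hvec y) (hvec z))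
  have c2 := (continuous_det3 (continuous_const (y := hvec x)) continuous_hvec
    (continuous_const (y := hvec z))).div_const (det3 (hvec x) (hvec y) (hvec z))
  have c3 := (continuous_det3 (continuous_const (y := hvec x)) (continuous_const (y := hvec y))
    continuous_hvec).div_const (det3 (hvec x) (hvec y) (hvec z))
  rw [mem_interior_iff_mem_nhds]
  filter_upwards [c1.continuousAt.eventually (lt_mem_nhds h1),
    c2.continuousAt.eventually (lt_mem_nhds h2), c3.continuousAt.eventually (lt_mem_nhds h3)]
    with r i1 i2 i3
  exact hC.mem_of_comb hx hy hz i1.le i2.le i3.le (hvec_eq_comb_of_det3_ne_zero h _)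

lemma hvec_eq_comb_of_mem_hypSegment {x y p : ℍ} (hp : p ∈ hypSegment x y) (hpx : p ≠ x)
    (hpy : p ≠ y) : ∃ α β : ℝ, 0 < α ∧ 0 < β ∧ hvec p = α • hvec x + β • hvec y := by
  have hxp : 0 < dist x p := dist_pos.2 hpx.symm
  have hyp : 0 < dist p y := dist_pos.2 hpy
  have hpe := hp
  simp only [hypSegment, mem_ofPred_eq] at hpe
  have hL : 0 < dist x y := by linarith
  obtain ⟨c, hc, hx, hy⟩ := exists_line (dist_pos.1 hL)
  have e := eq_line_of_mem_hypSegment hc hL (p := p) (by rw [hx, hy]; exact hp)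
  rw [zero_add, hx] at e
  have hv := hvec_line hc hL.ne (dist x p)
  rw [← e, hx, hy, sub_zero, sub_zero] at hv
  refine ⟨_, _, ?_, ?_, hv⟩
  · exact div_pos (sinh_pos_iff.2 (by linarith)) (sinh_pos_iff.2 hL)
  · exact div_pos (sinh_pos_iff.2 hxp) (sinh_pos_iff.2 hL)

/-- Near an inner point of a segment `[x, y]` contained in a convex set `C`, the set `C` contains
everything on the side of `[x, y]` on which it has a point `z`. -/
lemma _root_.HypConvex.eventually_mem_of_mem_hypSegment {C : Set ℍ} (hC : HypConvex C) {x y z p : ℍ}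
    (hx : x ∈ C) (hy : y ∈ C) (hz : z ∈ C) (h : det3 (hvec x) (hvec y) (hvec z) ≠ 0)
    (hp : p ∈ hypSegment x y) (hpx : p ≠ x) (hpy : p ≠ y) :
    ∀ᶠ q in 𝓝 p, 0 < det3 (hvec x) (hvec y) (hvec q) * det3 (hvec x) (hvec y) (hvec z) →
      q ∈ interior C := by
  obtain ⟨α, β, hα, hβ, hv⟩ := hvec_eq_comb_of_mem_hypSegment hp hpx hpy
  have c1 := (continuous_det3 continuous_hvec (continuous_const (y := hvec y))
    (continuous_const (y := hvec z))).div_const (det3 (hvec x) (hvec y) (hvec z))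
  have c2 := (continuous_det3 (continuous_const (y := hvec x)) continuous_hvec
    (continuous_const (y := hvec z))).div_const (det3 (hvec x) (hvec y) (hvec z))
  have i1 : 0 < det3 (hvec p) (hvec y) (hvec z) / det3 (hvec x) (hvec y) (hvec z) := by
    have : det3 (hvec p) (hvec y) (hvec z) = α * det3 (hvec x) (hvec y) (hvec z) := by
      rw [hv]
      simp only [det3, Prod.fst_add, Prod.snd_add, Prod.smul_fst, Prod.smul_snd, smul_eq_mul]
      ring
    rw [this, mul_div_cancel_right₀ _ h]
    exact hα
  have i2 : 0 < det3 (hvec x) (hvec p) (hvec z) / det3 (hvec x) (hvec y) (hvec z) := by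
    have : det3 (hvec x) (hvec p) (hvec z) = β * det3 (hvec x) (hvec y) (hvec z) := by
      rw [hv]
      simp only [det3, Prod.fst_add, Prod.snd_add, Prod.smul_fst, Prod.smul_snd, smul_eq_mul]
      ring
    rw [this, mul_div_cancel_right₀ _ h]
    exact hβ
  filter_upwards [c1.continuousAt.eventually (lt_mem_nhds i1),
    c2.continuousAt.eventually (lt_mem_nhds i2)] with r j1 j2 j3
  refine hC.mem_interior_of_det3_pos hx hy hz h j1 j2 ?_
  rcases lt_or_gt_of_ne h with h' | h'
  · exact div_pos_of_neg_of_neg (by nlinarith) h'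
  · exact div_pos (by nlinarith) h'

/-- A line of the hyperbolic plane has no interior points. -/
lemma exists_mem_det3_ne_zero {x y : ℍ} (hxy : x ≠ y) {U : Set ℍ} (hU : IsOpen U)
    (hne : U.Nonempty) : ∃ q ∈ U, det3 (hvec x) (hvec y) (hvec q) ≠ 0 := by
  by_contra! hcon
  obtain ⟨q, hq⟩ := hne
  have hO : IsOpen ((↑) '' U : Set ℂ) := UpperHalfPlane.isOpenEmbedding_coe.isOpenMap _ hU
  obtain ⟨ε, hε, hball⟩ := Metric.isOpen_iff.1 hO (q : ℂ) ⟨q, hq, rfl⟩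
  obtain ⟨r, hr, hrq⟩ := hball (show (q : ℂ) + (ε / 2 : ℝ) ∈ _ by
    rw [Metric.mem_ball, dist_eq_norm, add_sub_cancel_left, Complex.norm_real, Real.norm_eq_abs,
      abs_of_pos (by positivity)]
    linarith)
  obtain ⟨s, hs, hsq⟩ := hball (show (q : ℂ) + (ε / 2 : ℝ) * Complex.I ∈ _ by
    rw [Metric.mem_ball, dist_eq_norm, add_sub_cancel_left, norm_mul, Complex.norm_I, mul_one,
      Complex.norm_real, Real.norm_eq_abs, abs_of_pos (by positivity)]
    linarith)
  have r1 : r.re = q.re + ε / 2 := by simpa using congrArg Complex.re hrq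
  have r2 : r.im = q.im := by simpa using congrArg Complex.im hrq
  have s1 : s.re = q.re := by simpa using congrArg Complex.re hsq
  have s2 : s.im = q.im + ε / 2 := by simpa using congrArg Complex.im hsq
  -- the determinant is `(n₁ + n₂ * re + n₃ * (re ^ 2 + im ^ 2)) / im`
  set n₁ := (hvec x).2.1 * (hvec y).2.2 - (hvec x).2.2 * (hvec y).2.1 with hn₁
  set n₂ := -((hvec x).1 * (hvec y).2.2 - (hvec x).2.2 * (hvec y).1) with hn₂
  set n₃ := (hvec x).1 * (hvec y).2.1 - (hvec x).2.1 * (hvec y).1 with hn₃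
  have key : ∀ z ∈ U, n₁ + n₂ * z.re + n₃ * (z.re ^ 2 + z.im ^ 2) = 0 := by
    intro z hz
    have h := hcon z hz
    have hz0 := z.im_pos.ne'
    have e : det3 (hvec x) (hvec y) (hvec z)
        = (n₁ + n₂ * z.re + n₃ * (z.re ^ 2 + z.im ^ 2)) / z.im := by
      have e1 : (hvec z).1 = 1 / z.im := rfl
      have e2 : (hvec z).2.1 = z.re / z.im := rfl
      have e3 : (hvec z).2.2 = (z.re ^ 2 + z.im ^ 2) / z.im := rfl
      simp only [det3, e1, e2, e3, hn₁, hn₂, hn₃]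
      field_simp
      ring
    rw [e, div_eq_zero_iff] at h
    exact h.resolve_right hz0
  have kq := key q hq
  have kr := key r hr
  have ks := key s hs
  rw [r1, r2] at kr
  rw [s1, s2] at ks
  have hn3 : n₃ = 0 := by
    have : n₃ * (ε / 2 * (2 * q.im + ε / 2)) = 0 := by linear_combination ks - kq
    have hpos := q.im_pos
    exact (mul_eq_zero.1 this).resolve_right (by positivity)
  have hn2 : n₂ = 0 := by
    have : n₂ * (ε / 2) = 0 := by
      rw [hn3] at kr kq
      linear_combination kr - kq
    exact (mul_eq_zero.1 this).resolve_right (by positivity)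
  have hx0 := (hvec_fst_pos x).ne'
  have hy0 := (hvec_fst_pos y)
  have hprop : hvec y = ((hvec y).1 / (hvec x).1) • hvec x + (0 : ℝ) • hvec x := by
    refine Prod.ext ?_ (Prod.ext ?_ ?_) <;>
      simp only [Prod.fst_add, Prod.snd_add, Prod.smul_fst, Prod.smul_snd, smul_eq_mul] <;>
      field_simp <;> linarith
  have hmem := mem_hypSegment_of_comb (div_pos hy0 (hvec_fst_pos x)).le le_rfl hprop
  simp only [hypSegment, mem_ofPred_eq, dist_self] at hmem
  have h0 : dist x y = 0 := by
    linarith [dist_nonneg (x := x) (y := y), dist_nonneg (x := y) (y := x)]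
  exact hxy (dist_eq_zero.1 h0)

/-- Every nonempty open set contains a point `y` such that the line through `x` and `y` avoids a
given finite set of points. -/
lemma exists_mem_forall_det3_ne_zero {x : ℍ} {F : Set ℍ} (hF : F.Finite) (hx : x ∉ F) {U : Set ℍ}
    (hU : IsOpen U) (hne : U.Nonempty) :
    ∃ y ∈ U, ∀ w ∈ F, det3 (hvec x) (hvec w) (hvec y) ≠ 0 := by
  -- strengthened to an open set of such points, for the induction on the finite set
  suffices h : ∃ V ⊆ U, IsOpen V ∧ V.Nonempty ∧
      ∀ y ∈ V, ∀ w ∈ F, det3 (hvec x) (hvec w) (hvec y) ≠ 0 by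
    obtain ⟨V, hVU, -, ⟨y, hy⟩, hV⟩ := h
    exact ⟨y, hVU hy, hV y hy⟩
  induction F, hF using Set.Finite.induction_on with
  | empty => exact ⟨U, Subset.rfl, hU, hne, by simp⟩
  | @insert a s _ _ ih =>
    obtain ⟨V, hVU, hVo, hVne, hV⟩ := ih fun h => hx (mem_insert_of_mem _ h)
    have hxa : x ≠ a := fun h => hx (h ▸ mem_insert _ _)
    obtain ⟨y, hy, hya⟩ := exists_mem_det3_ne_zero hxa hVo hVne
    refine ⟨V ∩ {y | det3 (hvec x) (hvec a) (hvec y) ≠ 0}, inter_subset_left.trans hVU,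
      hVo.inter ((isOpen_ne).preimage (continuous_det3 continuous_const continuous_const
        continuous_hvec)), ⟨y, hy, hya⟩, ?_⟩
    rintro r ⟨hr, hra⟩ w hw
    rcases hw with rfl | hw
    · exact hra
    · exact hV r hr w hw

lemma _root_.HypConvex.subset_closure_interior {C : Set ℍ} (hC : HypConvex C)
    (hne : (interior C).Nonempty) : C ⊆ closure (interior C) := by
  intro p hp
  obtain ⟨z, hz⟩ := hne
  rcases eq_or_ne p z with rfl | hpz
  · exact subset_closure hz
  -- The point `p` is a limit of points of the open triangle `p z y`, taken on the segment from `p`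
  -- to the midpoint `r` of `[z, y]`.
  obtain ⟨y, hy, hD⟩ := exists_mem_det3_ne_zero hpz isOpen_interior ⟨z, hz⟩
  have hzy : z ≠ y := by
    rintro rfl
    exact hD (by simp only [det3]; ring)
  obtain ⟨r, hr⟩ := exists_isHypMidpoint z y
  have hzy' := dist_pos.2 hzy
  have hr' : r ∈ hypSegment z y := by simp only [hypSegment, mem_ofPred_eq, hr.1, hr.2]; ring
  obtain ⟨α, β, hα, hβ, hv⟩ := hvec_eq_comb_of_mem_hypSegment hr'
    (by rintro rfl; have := hr.1; rw [dist_self] at this; linarith)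
    (by rintro rfl; have := hr.2; rw [dist_self] at this; linarith)
  have hpr : p ≠ r := by
    rintro rfl
    apply hD
    rw [hv]
    simp only [det3, Prod.fst_add, Prod.snd_add, Prod.smul_fst, Prod.smul_snd, smul_eq_mul]
    ring
  obtain ⟨c, hc, hc0, hcr⟩ := exists_line hpr
  have hL := dist_pos.2 hpr
  have hS := sinh_pos_iff.2 hL
  rw [← hc0]
  refine mem_closure_of_tendsto (f := c) (b := 𝓝[>] 0)
    ((hc.continuous.tendsto 0).mono_left nhdsWithin_le_nhds) ?_
  filter_upwards [Ioo_mem_nhdsGT hL] with t ht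
  have hvt := hvec_line hc hL.ne t
  rw [hc0, hcr, hv, sub_zero, sub_zero] at hvt
  have a1 : 0 < sinh (dist p r - t) / sinh (dist p r) :=
    div_pos (sinh_pos_iff.2 (by linarith [ht.2])) hS
  have a2 : 0 < sinh t / sinh (dist p r) := div_pos (sinh_pos_iff.2 ht.1) hS
  set s₁ := sinh (dist p r - t) / sinh (dist p r)
  set s₂ := sinh t / sinh (dist p r)
  refine hC.mem_interior_of_det3_pos hp (interior_subset hz) (interior_subset hy) hD ?_ ?_ ?_
  · have : det3 (hvec (c t)) (hvec z) (hvec y) = s₁ * det3 (hvec p) (hvec z) (hvec y) := by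
      rw [hvt]
      simp only [det3, Prod.fst_add, Prod.snd_add, Prod.smul_fst, Prod.smul_snd, smul_eq_mul]
      ring
    rw [this, mul_div_cancel_right₀ _ hD]; exact a1
  · have : det3 (hvec p) (hvec (c t)) (hvec y)
        = (s₂ * α) * det3 (hvec p) (hvec z) (hvec y) := by
      rw [hvt]
      simp only [det3, Prod.fst_add, Prod.snd_add, Prod.smul_fst, Prod.smul_snd, smul_eq_mul]
      ring
    rw [this, mul_div_cancel_right₀ _ hD]; positivity
  · have : det3 (hvec p) (hvec z) (hvec (c t))
        = (s₂ * β) * det3 (hvec p) (hvec z) (hvec y) := by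
      rw [hvt]
      simp only [det3, Prod.fst_add, Prod.snd_add, Prod.smul_fst, Prod.smul_snd, smul_eq_mul]
      ring
    rw [this, mul_div_cancel_right₀ _ hD]; positivity

lemma _root_.HypConvex.image {C : Set ℍ} (hC : HypConvex C) (g : ℍ ≃ᵢ ℍ) : HypConvex (g '' C) := by
  rintro _ ⟨x, hx, rfl⟩ _ ⟨y, hy, rfl⟩
  rw [← image_hypSegment]
  exact image_mono (hC x hx y hy)

lemma _root_.HypConvex.line_mem {C : Set ℍ} (hC : HypConvex C) {c : ℝ → ℍ} (hc : Isometry c)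
    {a b t : ℝ} (ha : c a ∈ C) (hb : c b ∈ C) (h1 : a ≤ t) (h2 : t ≤ b) : c t ∈ C :=
  hC _ ha _ hb (mem_hypSegment_line hc h1 h2)

/-- The distance to a point is quasiconvex along segments. -/
lemma dist_le_max_of_mem_hypSegment {x y p : ℍ} (z : ℍ) (hp : p ∈ hypSegment x y) :
    dist z p ≤ max (dist z x) (dist z y) := by
  rcases eq_or_ne p x with rfl | hpx
  · exact le_max_left _ _
  rcases eq_or_ne p y with rfl | hpy
  · exact le_max_right _ _
  obtain ⟨α, β, hα, hβ, hv⟩ := hvec_eq_comb_of_mem_hypSegment hp hpx hpy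
  have h1 := lor_hvec_self p
  rw [hv, lor_comb_left, lor_comb_right, lor_comb_right, lor_hvec_self, lor_hvec_self, lor_hvec,
    lor_hvec, dist_comm y x] at h1
  have h2 := lor_hvec z p
  rw [hv, lor_comb_right, lor_hvec, lor_hvec] at h2
  have hαβ : α + β ≤ 1 := by
    have := one_le_cosh (dist x y)
    have : 0 ≤ α * β * (cosh (dist x y) - 1) := by
      apply mul_nonneg (by positivity); linarith
    nlinarith
  set M := max (dist z x) (dist z y)
  have hM : 0 ≤ M := dist_nonneg.trans (le_max_left _ _)
  have i1 : cosh (dist z x) ≤ cosh M := by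
    rw [cosh_le_cosh, abs_of_nonneg dist_nonneg, abs_of_nonneg hM]; exact le_max_left _ _
  have i2 : cosh (dist z y) ≤ cosh M := by
    rw [cosh_le_cosh, abs_of_nonneg dist_nonneg, abs_of_nonneg hM]; exact le_max_right _ _
  have : cosh (dist z p) ≤ cosh M := by
    rw [← h2]
    have j1 := mul_le_mul_of_nonneg_left i1 hα.le
    have j2 := mul_le_mul_of_nonneg_left i2 hβ.le
    have j3 := mul_le_mul_of_nonneg_right hαβ (cosh_pos M).le
    linarith
  rwa [cosh_le_cosh, abs_of_nonneg dist_nonneg, abs_of_nonneg hM] at this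

/-! ### Convex polygons -/

section Polygon

variable {N : ℕ} [NeZero N] {Γ : Subgroup (ℍ ≃ᵢ ℍ)} {P : Set ℍ} {v : Fin N → ℍ}

lemma isCompact_hypSegment (x y : ℍ) : IsCompact (hypSegment x y) := by
  refine (isCompact_closedBall x (dist x y)).of_isClosed_subset
    (isClosed_eq (by fun_prop) continuous_const) fun p hp => ?_
  rw [Metric.mem_closedBall]
  exact dist_le_of_mem_hypSegment hp (left_mem_hypSegment x y)

lemma fin_add_one_ne (hN : 3 ≤ N) (i : Fin N) : i + 1 ≠ i := by
  obtain ⟨n, rfl⟩ : ∃ n, N = n + 3 := ⟨N - 3, by omega⟩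
  intro h
  simp at h

lemma _root_.IsConvexPolygon.vertex_ne (h : IsConvexPolygon P v) (i : Fin N) :
    v i ≠ v (i + 1) := fun e =>
  fin_add_one_ne h.three_le i (h.vertex_injective e).symm

lemma _root_.IsConvexPolygon.side_subset (h : IsConvexPolygon P v) (i : Fin N) :
    polySide v i ⊆ P := by
  intro p hp
  have : p ∈ frontier P := by rw [h.frontier_eq]; exact mem_iUnion.2 ⟨i, hp⟩
  exact h.isCompact.isClosed.frontier_subset this

lemma _root_.IsConvexPolygon.vertex_mem (h : IsConvexPolygon P v) (i : Fin N) : v i ∈ P :=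
  h.side_subset i (left_mem_hypSegment _ _)

lemma minGap_le_dist {i j : Fin N} (hij : NonAdjacentSides i j) {p q : ℍ}
    (hp : p ∈ polySide v i) (hq : q ∈ polySide v j) : minGap v ≤ dist p q := by
  rw [minGap, ← ENNReal.toReal_ofReal (dist_nonneg (x := p) (y := q)), ← edist_dist]
  refine ENNReal.toReal_mono (edist_ne_top _ _) ((min_le_left _ _).trans ?_)
  exact iInf_le_of_le i (iInf_le_of_le j (iInf_le_of_le hij (iInf₂_le_of_le p hp
    (iInf₂_le_of_le q hq le_rfl))))

lemma midpointGap_le_edist {i j : Fin N} (hij : AdjacentSides i j) {m q : ℍ}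
    (hm : IsHypMidpoint (v i) (v (i + 1)) m) (hq : q ∈ polySide v j) :
    midpointGap v ≤ edist m q :=
  iInf_le_of_le i (iInf_le_of_le j (iInf_le_of_le hij (iInf₂_le_of_le m hm
    (iInf₂_le_of_le q hq le_rfl))))

lemma half_minGap_le_dist {i j : Fin N} (hij : AdjacentSides i j) {m q : ℍ}
    (hm : IsHypMidpoint (v i) (v (i + 1)) m) (hq : q ∈ polySide v j) :
    minGap v / 2 ≤ dist m q := by
  have h : minGap v ≤ (2 * edist m q).toReal := by
    refine ENNReal.toReal_mono (ENNReal.mul_ne_top (by simp) (edist_ne_top _ _))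
      ((min_le_right _ _).trans ?_)
    gcongr
    exact midpointGap_le_edist hij hm hq
  rw [ENNReal.toReal_mul, edist_dist, ENNReal.toReal_ofReal dist_nonneg] at h
  simp at h
  linarith

lemma mem_hypSegment_of_isHypMidpoint {x y m : ℍ} (h : IsHypMidpoint x y m) :
    m ∈ hypSegment x y := by
  simp only [hypSegment, mem_ofPred_eq, h.1, h.2]; ring

lemma isHypMidpoint_comm {x y m : ℍ} (h : IsHypMidpoint x y m) : IsHypMidpoint y x m :=
  ⟨by rw [dist_comm y m, dist_comm y x]; exact h.2, by rw [dist_comm m x, dist_comm y x]; exact h.1⟩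

lemma sideGap_pos (h : IsConvexPolygon P v) : 0 < sideGap v := by
  obtain ⟨i, hi⟩ := exists_eq_ciInf_of_finite (f := fun i : Fin N => ⨅ (j : Fin N)
    (_ : NonAdjacentSides i j) (p ∈ polySide v i) (q ∈ polySide v j), edist p q)
  rw [sideGap, ← hi]
  obtain ⟨j, hj⟩ := exists_eq_ciInf_of_finite (f := fun j : Fin N =>
    ⨅ (_ : NonAdjacentSides i j) (p ∈ polySide v i) (q ∈ polySide v j), edist p q)
  rw [← hj]
  by_cases hij : NonAdjacentSides i j
  · obtain ⟨r, hr, hlt⟩ := Metric.exists_pos_forall_lt_edist (isCompact_hypSegment _ _)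
      (isCompact_hypSegment _ _).isClosed (h.side_disjoint i j hij)
    exact (ENNReal.coe_pos.2 hr).trans_le (le_iInf fun _ => le_iInf₂ fun p hp =>
      le_iInf₂ fun q hq => (hlt p hp q hq).le)
  · simp [hij]

lemma midpoint_notMem_of_adjacent (h : IsConvexPolygon P v) {i j : Fin N}
    (hij : AdjacentSides i j) {m : ℍ} (hm : IsHypMidpoint (v i) (v (i + 1)) m) :
    m ∉ polySide v j := by
  intro hmj
  have hne := dist_pos.2 (h.vertex_ne i)
  have hmi : m ∈ polySide v i := mem_hypSegment_of_isHypMidpoint hm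
  rcases hij with rfl | rfl
  · have : m ∈ ({v (i + 1)} : Set ℍ) := h.side_inter_succ i ▸ ⟨hmi, hmj⟩
    have h2 := hm.2
    rw [mem_singleton_iff.1 this, dist_self] at h2
    linarith
  · have : m ∈ ({v (j + 1)} : Set ℍ) := h.side_inter_succ j ▸ ⟨hmj, hmi⟩
    have h2 := hm.1
    rw [mem_singleton_iff.1 this, dist_self] at h2
    linarith

lemma midpointGap_pos (h : IsConvexPolygon P v) : 0 < midpointGap v := by
  obtain ⟨i, hi⟩ := exists_eq_ciInf_of_finite (f := fun i : Fin N => ⨅ (j : Fin N)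
    (_ : AdjacentSides i j) (m : ℍ) (_ : IsHypMidpoint (v i) (v (i + 1)) m) (q ∈ polySide v j),
      edist m q)
  rw [midpointGap, ← hi]
  obtain ⟨j, hj⟩ := exists_eq_ciInf_of_finite (f := fun j : Fin N =>
    ⨅ (_ : AdjacentSides i j) (m : ℍ) (_ : IsHypMidpoint (v i) (v (i + 1)) m) (q ∈ polySide v j),
      edist m q)
  rw [← hj]
  by_cases hij : AdjacentSides i j
  · have hcl : IsClosed {m | IsHypMidpoint (v i) (v (i + 1)) m} :=
      (isClosed_eq (by fun_prop) continuous_const).inter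
        (isClosed_eq (by fun_prop) continuous_const)
    obtain ⟨r, hr, hlt⟩ := Metric.exists_pos_forall_lt_edist
      ((isCompact_hypSegment (v i) (v (i + 1))).of_isClosed_subset hcl
        fun m hm => mem_hypSegment_of_isHypMidpoint hm)
      (isCompact_hypSegment (v j) (v (j + 1))).isClosed
      (disjoint_left.2 fun m hm => midpoint_notMem_of_adjacent h hij hm)
    exact (ENNReal.coe_pos.2 hr).trans_le (le_iInf fun _ => le_iInf₂ fun p hp =>
      le_iInf₂ fun q hq => (hlt p hp q hq).le)
  · simp [hij]

lemma minGap_pos (h : IsConvexPolygon P v) : 0 < minGap v := by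
  refine ENNReal.toReal_pos (lt_min (sideGap_pos h)
    (ENNReal.mul_pos (by simp) (midpointGap_pos h).ne')).ne' ?_
  obtain ⟨m, hm⟩ := exists_isHypMidpoint (v 0) (v (0 + 1))
  have := midpointGap_le_edist (j := 0 + 1) (Or.inl rfl) hm (left_mem_hypSegment _ _)
  refine ((min_le_right _ _).trans_lt (ENNReal.mul_lt_top (by simp) ?_)).ne
  exact this.trans_lt (edist_lt_top _ _)

/-- `IsCorner i j k`: the sides `i` and `j` are adjacent, with common end `v k`. -/
def IsCorner (i j k : Fin N) : Prop := (j = i + 1 ∧ k = j) ∨ (i = j + 1 ∧ k = i)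

lemma exists_isCorner {i j : Fin N} (h : AdjacentSides i j) : ∃ k, IsCorner i j k :=
  h.elim (fun h => ⟨j, Or.inl ⟨h, rfl⟩⟩) fun h => ⟨i, Or.inr ⟨h, rfl⟩⟩

lemma IsCorner.symm {i j k : Fin N} (h : IsCorner i j k) : IsCorner j i k :=
  h.elim (fun h => Or.inr ⟨h.1, h.2⟩) fun h => Or.inl ⟨h.1, h.2⟩

lemma IsCorner.adjacent {i j k : Fin N} (h : IsCorner i j k) : AdjacentSides i j :=
  h.elim (fun h => Or.inl h.1) fun h => Or.inr h.1

lemma IsCorner.eq_or_eq {i j k : Fin N} (h : IsCorner i j k) : k = i ∨ k = i + 1 :=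
  h.elim (fun h => Or.inr (h.2.trans h.1)) fun h => Or.inl h.2

/-- The distance from a point of a side to an adjacent side, in terms of its distance to the common
end. -/
lemma IsCorner.sinh_mul_sinh_le (h : IsConvexPolygon P v) {i j k : Fin N} (hk : IsCorner i j k)
    {p q : ℍ} (hp : p ∈ polySide v i) (hq : q ∈ polySide v j) :
    sinh (minGap v / 2) * sinh (dist (v k) p)
      ≤ sinh (dist p q) * sinh (dist (v i) (v (i + 1)) / 2) := by
  have hμ : 0 ≤ minGap v / 2 := by have := minGap_pos h; positivity
  have hadj := hk.adjacent
  have hadj' := hk.symm.adjacent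
  rcases hk with ⟨rfl, rfl⟩ | ⟨rfl, rfl⟩
  · rw [dist_comm (v i)]
    rw [polySide, hypSegment_comm] at hp
    refine sinh_mul_sinh_le_of_midpoints (h.vertex_ne i).symm (h.vertex_ne _) hμ ?_ ?_ hp hq
    · exact fun m hm q hq => half_minGap_le_dist hadj (isHypMidpoint_comm hm) hq
    · refine fun m hm q hq => half_minGap_le_dist hadj' hm ?_
      rwa [polySide, hypSegment_comm]
  · rw [polySide, hypSegment_comm] at hq
    refine sinh_mul_sinh_le_of_midpoints (h.vertex_ne _) (h.vertex_ne j).symm hμ ?_ ?_ hp hq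
    · refine fun m hm q hq => half_minGap_le_dist hadj hm ?_
      rwa [polySide, hypSegment_comm]
    · exact fun m hm q hq => half_minGap_le_dist hadj' (isHypMidpoint_comm hm) hq

lemma minGap_le_side (v : Fin N → ℍ) (i : Fin N) :
    minGap v / 2 ≤ dist (v i) (v (i + 1)) / 2 := by
  obtain ⟨m, hm⟩ := exists_isHypMidpoint (v i) (v (i + 1))
  rw [← hm.2]
  exact half_minGap_le_dist (Or.inl rfl) hm (left_mem_hypSegment _ _)

/-- The last point of a geodesic line in a compact set. -/
lemma exists_exit {C : Set ℍ} (hC : IsCompact C) {c : ℝ → ℍ} (hc : Isometry c) {b : ℝ}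
    (hb : c b ∈ C) : ∃ t, b ≤ t ∧ c t ∈ C ∧ ∀ s > t, c s ∉ C := by
  have hcomp : IsCompact (c ⁻¹' C) := hc.isClosedEmbedding.isCompact_preimage hC
  obtain ⟨t, ht, hmax⟩ := hcomp.exists_isGreatest ⟨b, hb⟩
  exact ⟨t, hmax hb, ht, fun s hs hsC => absurd (hmax hsC) (not_le.2 hs)⟩

lemma mem_frontier_of_exit {C : Set ℍ} {c : ℝ → ℍ} (hc : Continuous c) {b : ℝ}
    (hb : c b ∈ C) (hexit : ∀ t > b, c t ∉ C) : c b ∈ frontier C := by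
  refine ⟨subset_closure hb, fun hint => ?_⟩
  have h1 : ∀ᶠ t in 𝓝[>] b, c t ∈ interior C :=
    (hc.continuousAt.eventually (isOpen_interior.mem_nhds hint)).filter_mono nhdsWithin_le_nhds
  obtain ⟨t, ht, htb⟩ := (h1.and self_mem_nhdsWithin).exists
  exact hexit t htb (interior_subset ht)

/-- From a point `z` of a polygon, no point of the polygon is farther than all vertices. -/
lemma _root_.IsConvexPolygon.exists_dist_le_dist_vertex (h : IsConvexPolygon P v) (z : ℍ)
    {w : ℍ} (hw : w ∈ P) : ∃ i, dist z w ≤ dist z (v i) := by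
  rcases eq_or_ne z w with rfl | hne
  · exact ⟨0, by simp⟩
  obtain ⟨c, hc, hc0, hcL⟩ := exists_line hne
  -- prolong the segment from `z` to `w` until it leaves the polygon through a side
  obtain ⟨t, htL, htP, hexit⟩ := exists_exit h.isCompact hc (b := dist z w) (by rwa [hcL])
  have hfr := mem_frontier_of_exit hc.continuous htP hexit
  rw [h.frontier_eq] at hfr
  obtain ⟨i, hi⟩ := mem_iUnion.1 hfr
  have h1 : dist z w ≤ dist z (c t) := by
    have e : dist (c 0) (c t) = |0 - t| := hc.dist_eq _ _
    rw [hc0, zero_sub, abs_neg] at e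
    rw [e]
    exact htL.trans (le_abs_self t)
  rcases le_max_iff.1 (h1.trans (dist_le_max_of_mem_hypSegment z hi)) with h2 | h2
  · exact ⟨i, h2⟩
  · exact ⟨i + 1, h2⟩

lemma _root_.IsConvexPolygon.dist_le_maxVertexDist (h : IsConvexPolygon P v) {z w : ℍ}
    (hz : z ∈ P) (hw : w ∈ P) : dist z w ≤ maxVertexDist v := by
  obtain ⟨i, hi⟩ := h.exists_dist_le_dist_vertex z hw
  obtain ⟨j, hj⟩ := h.exists_dist_le_dist_vertex (v i) hz
  have h1 : dist (v i) (v j) ≤ maxVertexDist v :=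
    (le_ciSup (f := fun j => dist (v i) (v j)) (finite_range _).bddAbove j).trans
      (le_ciSup (f := fun i => ⨆ j, dist (v i) (v j)) (finite_range _).bddAbove i)
  rw [dist_comm z (v i)] at hi
  exact hi.trans (hj.trans h1)

/-! ### The tessellation -/

lemma interior_image (g : ℍ ≃ᵢ ℍ) (C : Set ℍ) : interior (g '' C) = g '' interior C :=
  (g.toHomeomorph.image_interior C).symm

/-- An interior point of a tile lies in no other tile. -/
lemma _root_.IsFundamentalPolygon.eq_of_mem_interior (hP : IsFundamentalPolygon Γ P v)
    {g h : ℍ ≃ᵢ ℍ} (hg : g ∈ Γ) (hh : h ∈ Γ) {x : ℍ} (hx : x ∈ g '' interior P)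
    (hx' : x ∈ h '' P) : g = h := by
  by_contra hne
  have hO : IsOpen (g '' interior P) := g.toHomeomorph.isOpenMap _ isOpen_interior
  have hcl : x ∈ closure (h '' interior P) := by
    have e : h '' closure (interior P) = closure (h '' interior P) :=
      h.toHomeomorph.image_closure _
    rw [← e]
    exact image_mono (hP.polygon.convex.subset_closure_interior hP.polygon.interior_nonempty) hx'
  obtain ⟨y, ⟨a, ha, rfl⟩, ⟨b, hb, hab⟩⟩ := mem_closure_iff.1 hcl _ hO hx
  have hd := hP.interior_disjoint (g⁻¹ * h) (Γ.mul_mem (Γ.inv_mem hg) hh)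
    (fun e => hne (inv_mul_eq_one.1 e))
  refine disjoint_left.1 hd ⟨b, hb, ?_⟩ ha
  rw [IsometryEquiv.mul_apply, hab, IsometryEquiv.inv_apply_self]

/-- A discontinuous group moves a point only finitely often into a ball. Stabilizers are finite
because an element is determined by the image of an interior point of the polygon. -/
lemma finite_setOf_dist_le (hΓ : IsFuchsian Γ) (hP : IsFundamentalPolygon Γ P v) (z w : ℍ)
    (R : ℝ) : {γ | γ ∈ Γ ∧ dist z (γ w) ≤ R}.Finite := by
  obtain ⟨x, hx⟩ := hP.polygon.interior_nonempty
  by_contra hinf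
  have hinj : InjOn (fun γ : ℍ ≃ᵢ ℍ => γ x) {γ | γ ∈ Γ ∧ dist z (γ w) ≤ R} := by
    intro g hg h hh e
    exact hP.eq_of_mem_interior hg.1 hh.1 (x := g x) ⟨x, hx, rfl⟩
      ⟨x, interior_subset hx, e.symm⟩
  have hinf' := Set.Infinite.image hinj hinf
  obtain ⟨y, -, hy⟩ := hinf'.exists_accPt_of_subset_isCompact
    (isCompact_closedBall z (R + dist w x)) (by
      rintro _ ⟨γ, hγ, rfl⟩
      rw [Metric.mem_closedBall, dist_comm]
      have := dist_triangle z (γ w) (γ x)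
      rw [γ.isometry.dist_eq] at this
      exact this.trans (by have := hγ.2; gcongr))
  refine hΓ.discontinuous x y (hy.mono (principal_mono.2 ?_))
  rintro _ ⟨γ, hγ, rfl⟩
  exact ⟨γ, hγ.1, rfl⟩

/-- A line that leaves the polygon at a point other than a vertex enters the image of the polygon
under a side pairing. -/
lemma _root_.IsFundamentalPolygon.exists_crossing (hP : IsFundamentalPolygon Γ P v) {c : ℝ → ℍ}
    (hc : Isometry c) {b : ℝ} (hb : c b ∈ P) (hexit : ∀ t > b, c t ∉ P)
    (hav : ∀ t i, c t ≠ v i) : ∃ i j, ∃ γ ∈ Γ, c b ∈ polySide v i ∧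
      γ '' polySide v j = polySide v i ∧ ∀ᶠ t in 𝓝[>] b, c t ∈ γ '' P := by
  have hfr := mem_frontier_of_exit hc.continuous hb hexit
  rw [hP.polygon.frontier_eq] at hfr
  obtain ⟨i, hi⟩ := mem_iUnion.1 hfr
  obtain ⟨j, γ, hγ, hγ1, hside⟩ := hP.side_pairing i
  refine ⟨i, j, γ, hγ, hi, hside, ?_⟩
  have hu := hP.polygon.vertex_mem i
  have hu' := hP.polygon.vertex_mem (i + 1)
  have hne := hP.polygon.vertex_ne i
  have hsub : polySide v i ⊆ γ '' P := hside ▸ image_mono (hP.polygon.side_subset j)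
  have hγu : v i ∈ γ '' P := hsub (left_mem_hypSegment _ _)
  have hγu' : v (i + 1) ∈ γ '' P := hsub (right_mem_hypSegment _ _)
  have hconv := hP.polygon.convex
  obtain ⟨z, hz, hzD⟩ := exists_mem_det3_ne_zero hne isOpen_interior hP.polygon.interior_nonempty
  obtain ⟨z', hz', hzD'⟩ := exists_mem_det3_ne_zero hne (U := interior (γ '' P)) isOpen_interior
    (by rw [interior_image]; exact hP.polygon.interior_nonempty.image _)
  have e1 := hc.continuous.continuousAt.eventually (hconv.eventually_mem_of_mem_hypSegment hu hu'
    (interior_subset hz) hzD hi (hav b i) (hav b (i + 1)))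
  have e2 := hc.continuous.continuousAt.eventually ((hconv.image γ).eventually_mem_of_mem_hypSegment
    hγu hγu' (interior_subset hz') hzD' hi (hav b i) (hav b (i + 1)))
  -- along the line the determinant is a nonzero multiple of `sinh (t - b)`
  have hb0 : det3 (hvec (v i)) (hvec (v (i + 1))) (hvec (c b)) = 0 := by
    obtain ⟨α, β, -, -, h⟩ := hvec_eq_comb_of_mem_hypSegment hi (hav b i) (hav b (i + 1))
    rw [h]
    simp only [det3, Prod.fst_add, Prod.snd_add, Prod.smul_fst, Prod.smul_snd, smul_eq_mul]
    ring
  set K := det3 (hvec (v i)) (hvec (v (i + 1))) (hvec (c (b + 1))) / sinh 1 with hK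
  have hdet : ∀ t, det3 (hvec (v i)) (hvec (v (i + 1))) (hvec (c t)) = K * sinh (t - b) := by
    intro t
    have hlin : ∀ (α β : ℝ) (p q r s : ℝ × ℝ × ℝ),
        det3 p q (α • r + β • s) = α * det3 p q r + β * det3 p q s := by
      intro α β p q r s
      simp only [det3, Prod.fst_add, Prod.snd_add, Prod.smul_fst, Prod.smul_snd, smul_eq_mul]
      ring
    rw [hvec_line hc (a := b) (b := b + 1) (by linarith) t, hlin, hb0, add_sub_cancel_left, hK]
    ring
  have hK0 : K ≠ 0 := by
    intro hK0
    have h1 := hdet (b + 1)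
    rw [hK0, zero_mul] at h1
    obtain ⟨t, ht⟩ := exists_line_eq_of_det3_eq_zero hc hne (a := b) (b := b + 1) (by linarith)
      hb0 h1
    exact hav t i ht.symm
  set Dz := det3 (hvec (v i)) (hvec (v (i + 1))) (hvec z)
  set Dz' := det3 (hvec (v i)) (hvec (v (i + 1))) (hvec z')
  -- the polygon and its neighbour lie on different sides of their common side
  have hopp : ¬ 0 < Dz * Dz' := by
    intro hpos
    obtain ⟨t, ht1, ht2, ht3⟩ : ∃ t, (0 < det3 (hvec (v i)) (hvec (v (i + 1))) (hvec (c t)) * Dz →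
        c t ∈ interior P) ∧ (0 < det3 (hvec (v i)) (hvec (v (i + 1))) (hvec (c t)) * Dz' →
        c t ∈ interior (γ '' P)) ∧ 0 < K * sinh (t - b) * Dz := by
      rcases lt_or_gt_of_ne (mul_ne_zero hK0 hzD) with h | h
      · have e1' := e1.filter_mono (nhdsWithin_le_nhds (s := Iio b))
        have e2' := e2.filter_mono (nhdsWithin_le_nhds (s := Iio b))
        obtain ⟨t, ⟨h1, h2⟩, h3⟩ := ((e1'.and e2').and self_mem_nhdsWithin).exists
        have h4 : sinh (t - b) < 0 := sinh_neg_iff.2 (sub_neg.2 h3)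
        refine ⟨t, h1, h2, ?_⟩
        rw [mul_right_comm]; exact mul_pos_of_neg_of_neg h h4
      · have e1' := e1.filter_mono (nhdsWithin_le_nhds (s := Ioi b))
        have e2' := e2.filter_mono (nhdsWithin_le_nhds (s := Ioi b))
        obtain ⟨t, ⟨h1, h2⟩, h3⟩ := ((e1'.and e2').and self_mem_nhdsWithin).exists
        have h4 : 0 < sinh (t - b) := sinh_pos_iff.2 (sub_pos.2 h3)
        refine ⟨t, h1, h2, ?_⟩
        rw [mul_right_comm]; exact mul_pos h h4
    rw [hdet] at ht1 ht2
    have hm1 := ht1 ht3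
    have hm2 := ht2 (by
      have : 0 < (K * sinh (t - b) * Dz) * (Dz * Dz') := mul_pos ht3 hpos
      have h5 : 0 < Dz ^ 2 := by positivity
      by_contra hcon
      nlinarith)
    rw [interior_image] at hm2
    exact disjoint_left.1 (hP.interior_disjoint γ hγ hγ1) hm2 hm1
  filter_upwards [e1.filter_mono nhdsWithin_le_nhds, e2.filter_mono nhdsWithin_le_nhds,
    self_mem_nhdsWithin] with t h1 h2 h3
  rw [hdet] at h1 h2
  have h4 : 0 < sinh (t - b) := sinh_pos_iff.2 (sub_pos.2 h3)
  apply interior_subset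
  apply h2
  have h5 : K * sinh (t - b) * Dz < 0 := by
    refine lt_of_le_of_ne (not_lt.1 fun h => hexit t h3 (interior_subset (h1 h))) ?_
    exact mul_ne_zero (mul_ne_zero hK0 h4.ne') hzD
  have h6 : Dz * Dz' < 0 := lt_of_le_of_ne (not_lt.1 hopp) (mul_ne_zero hzD hzD')
  have h7 : 0 < (K * sinh (t - b) * Dz) * (Dz * Dz') := mul_pos_of_neg_of_neg h5 h6
  have h8 : 0 < Dz ^ 2 := by positivity
  by_contra hcon
  nlinarith

end Polygon

/-! ### Short segments stay in the star of a tile -/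

section Chain

variable {N : ℕ} [NeZero N] {Γ : Subgroup (ℍ ≃ᵢ ℍ)} {P : Set ℍ} {v : Fin N → ℍ}

lemma det3_eq_zero_of_mem_hypSegment {x y p : ℍ} (hxy : x ≠ y) (hp : p ∈ hypSegment x y) :
    det3 (hvec x) (hvec y) (hvec p) = 0 := by
  obtain ⟨c, hc, rfl, hy⟩ := exists_line hxy
  rw [← hy] at hp
  rw [eq_line_of_mem_hypSegment hc (dist_pos.2 hxy) hp]
  have h := det3_line_eq_zero hc 0 (dist (c 0) y) (0 + dist (c 0) p)
  rwa [hy] at h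

/-- A line that does not pass through the ends of a segment meets the segment at most once. -/
lemma eq_of_mem_hypSegment_of_line {c : ℝ → ℍ} (hc : Isometry c) {x y : ℍ} (hxy : x ≠ y)
    (hx : ∀ t, c t ≠ x) {a b : ℝ} (ha : c a ∈ hypSegment x y) (hb : c b ∈ hypSegment x y) :
    a = b := by
  by_contra hab
  obtain ⟨t, ht⟩ := exists_line_eq_of_det3_eq_zero hc hxy hab
    (det3_eq_zero_of_mem_hypSegment hxy ha) (det3_eq_zero_of_mem_hypSegment hxy hb)
  exact hx t ht.symm

/-- A geodesic ending at time `L` in the interior of the tile `g₀ P` leaves any other tile `g P`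
through one of its sides before time `L`, and goes on to the tile on the other side. -/
lemma _root_.IsFundamentalPolygon.exists_next (hP : IsFundamentalPolygon Γ P v) {c : ℝ → ℍ}
    (hc : Isometry c) {L : ℝ} {g₀ : ℍ ≃ᵢ ℍ} (hg₀ : g₀ ∈ Γ) (hL : c L ∈ g₀ '' interior P)
    {g : ℍ ≃ᵢ ℍ} (hg : g ∈ Γ) (hne : g ≠ g₀) (hav : ∀ t i, c t ≠ g (v i)) {b : ℝ} (hbL : b ≤ L)
    (hb : c b ∈ g '' P) :
    ∃ t, b ≤ t ∧ t < L ∧ c t ∈ g '' P ∧ (∀ s > t, c s ∉ g '' P) ∧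
      ∃ i j, ∃ g' ∈ Γ, c t ∈ g '' polySide v i ∧ g' '' polySide v j = g '' polySide v i ∧
        ∃ b' > t, b' ≤ L ∧ c b' ∈ g' '' P := by
  obtain ⟨t, hbt, htP, hexit⟩ := exists_exit (hP.polygon.isCompact.image g.continuous) hc hb
  have htL : t < L := by
    by_contra hcon
    exact hne (hP.eq_of_mem_interior hg₀ hg hL
      ((hP.polygon.convex.image g).line_mem hc hb htP hbL (not_lt.1 hcon))).symm
  refine ⟨t, hbt, htL, htP, hexit, ?_⟩
  -- apply the crossing lemma to the geodesic moved back to `P` by `g⁻¹`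
  have hmem : ∀ (h : ℍ ≃ᵢ ℍ) (A : Set ℍ) (y : ℍ), y ∈ h '' A ↔ h.symm y ∈ A := fun h A y =>
    ⟨by rintro ⟨a, ha, rfl⟩; simpa using ha, fun h' => ⟨_, h', h.apply_symm_apply y⟩⟩
  obtain ⟨i, j, γ, hγ, hi, hside, hev⟩ := hP.exists_crossing (c := fun t => g.symm (c t)) (b := t)
    (g.symm.isometry.comp hc) ((hmem _ _ _).1 htP) (fun s hs h => hexit s hs ((hmem _ _ _).2 h))
    (fun s i e => hav s i (by rw [← e, g.apply_symm_apply]))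
  have himg : ∀ A : Set ℍ, (g * γ) '' A = g '' (γ '' A) := fun A => by
    rw [image_image]; rfl
  refine ⟨i, j, g * γ, Γ.mul_mem hg hγ, (hmem _ _ _).2 hi, by rw [himg, hside], ?_⟩
  obtain ⟨b', hb', hb'L⟩ := (hev.and (Ioo_mem_nhdsGT htL)).exists
  exact ⟨b', hb'L.1, hb'L.2.le, by rw [himg]; exact (hmem _ _ _).2 hb'⟩

/-- `Reached Γ P v c L g` records how a geodesic `c`, starting in `P`, has come to the tile `g P`
before time `L`: at time `b` it entered `g P` through the side `j` of `g P`. Either this is also a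
side of `P`, or `c` came from a tile `σ P` which it crossed near one of its vertices, from the side
`i` to an adjacent side `i'` with common end `σ (v k)`, this point being a vertex of `P`. -/
def Reached (Γ : Subgroup (ℍ ≃ᵢ ℍ)) (P : Set ℍ) (v : Fin N → ℍ) (c : ℝ → ℍ) (L : ℝ)
    (g : ℍ ≃ᵢ ℍ) : Prop :=
  g ∈ Γ ∧ ∃ j b, 0 ≤ b ∧ c b ∈ g '' polySide v j ∧ (∃ b' > b, b' ≤ L ∧ c b' ∈ g '' P) ∧
    ((∃ i, g '' polySide v j = polySide v i) ∨
      ∃ σ ∈ Γ, ∃ i i' k i₀ a, 0 ≤ a ∧ a < b ∧ IsCorner i' i k ∧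
        σ '' polySide v i' = g '' polySide v j ∧ c a ∈ σ '' polySide v i ∧ σ (v k) = v i₀)

lemma image_polySide_eq {σ g : ℍ ≃ᵢ ℍ} {i j : Fin N}
    (h : σ '' polySide v i = g '' polySide v j) :
    σ (v i) = g (v j) ∧ σ (v (i + 1)) = g (v (j + 1)) ∨
      σ (v i) = g (v (j + 1)) ∧ σ (v (i + 1)) = g (v j) := by
  rw [polySide, polySide, image_hypSegment, image_hypSegment] at h
  exact eq_or_eq_of_hypSegment_eq h

lemma Reached.mem_neighborMaps {c : ℝ → ℍ} {L : ℝ} {g : ℍ ≃ᵢ ℍ} (h : Reached Γ P v c L g) :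
    g ∈ neighborMaps Γ v := by
  obtain ⟨hg, j, b, -, -, -, hcase⟩ := h
  refine ⟨hg, Or.inr ?_⟩
  rcases hcase with ⟨i, hi⟩ | ⟨σ, -, i, i', k, i₀, a, -, -, hk, hside, -, hσ⟩
  · exact Or.inl ⟨i, j, hi⟩
  · right
    rcases hk.eq_or_eq with rfl | rfl <;> rcases image_polySide_eq hside with ⟨e1, e2⟩ | ⟨e1, e2⟩
    · exact ⟨i₀, j, by rw [← e1, hσ]⟩
    · exact ⟨i₀, j + 1, by rw [← e1, hσ]⟩
    · exact ⟨i₀, j + 1, by rw [← e2, hσ]⟩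
    · exact ⟨i₀, j, by rw [← e2, hσ]⟩

/-- A geodesic that crosses a side of a polygon, coming from a side adjacent at one end and going
on to a side adjacent at the other end, has length at least `minGap v`. -/
lemma minGap_le_of_corners (hP : IsConvexPolygon P v) {c : ℝ → ℍ} (hc : Isometry c)
    {σ g : ℍ ≃ᵢ ℍ} {i i' k j j' l : Fin N} (hk : IsCorner i' i k) (hl : IsCorner j j' l)
    (hside : σ '' polySide v i' = g '' polySide v j) (hne : g (v l) ≠ σ (v k)) {a b t : ℝ}
    (hab : a < b) (hbt : b < t) (ha : c a ∈ σ '' polySide v i) (hb : c b ∈ g '' polySide v j)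
    (ht : c t ∈ g '' polySide v j') : minGap v ≤ t - a := by
  obtain ⟨q, hq, hqa⟩ := ha
  obtain ⟨r, hr, hrt⟩ := ht
  obtain ⟨p, hp, hpb⟩ : c b ∈ σ '' polySide v i' := hside ▸ hb
  obtain ⟨p', hp', hpb'⟩ := hb
  have w1 := hk.sinh_mul_sinh_le hP hp hq
  have w2 := hl.sinh_mul_sinh_le hP hp' hr
  rw [← σ.isometry.dist_eq, ← σ.isometry.dist_eq p q, ← σ.isometry.dist_eq (v i'), hpb, hqa,
    hc.dist_eq, Real.dist_eq, abs_of_pos (sub_pos.2 hab)] at w1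
  rw [← g.isometry.dist_eq, ← g.isometry.dist_eq p' r, ← g.isometry.dist_eq (v j), hpb', hrt,
    hc.dist_eq, Real.dist_eq, abs_sub_comm, abs_of_pos (sub_pos.2 hbt)] at w2
  have hlen : dist (σ (v i')) (σ (v (i' + 1))) = dist (g (v j)) (g (v (j + 1))) := by
    rcases image_polySide_eq hside with ⟨e1, e2⟩ | ⟨e1, e2⟩
    · rw [e1, e2]
    · rw [e1, e2, dist_comm]
  have hsum : dist (σ (v k)) (c b) + dist (g (v l)) (c b)
      = dist (g (v j)) (g (v (j + 1))) := by
    have e := hp'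
    simp only [polySide, hypSegment, mem_ofPred_eq] at e
    rw [← g.isometry.dist_eq, ← g.isometry.dist_eq p', ← g.isometry.dist_eq (v j) (v (j + 1)),
      hpb', dist_comm (c b)] at e
    rcases hk.eq_or_eq with rfl | rfl <;> rcases hl.eq_or_eq with rfl | rfl <;>
      rcases image_polySide_eq hside with ⟨e1, e2⟩ | ⟨e1, e2⟩ <;>
      simp only [e1, e2, ne_eq, not_true_eq_false] at hne ⊢ <;> linarith
  have hpos := dist_pos.2 (hP.vertex_ne j)
  -- the distances of `c b` to the two ends of the crossed side add up to its length
  have hle := minGap_le_side v j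
  rw [hlen] at w1
  rw [show dist (g (v l)) (c b) = dist (g (v j)) (g (v (j + 1))) - dist (σ (v k)) (c b) by
    linarith] at w2
  rw [g.isometry.dist_eq] at w1 w2
  have := two_mul_le_add_of_sinh_le (by have := minGap_pos hP; positivity) hle hpos w1 w2
  linarith

lemma finite_setOf_meets_closedBall (hΓ : IsFuchsian Γ) (hP : IsFundamentalPolygon Γ P v) (x : ℍ)
    (R : ℝ) : {g | g ∈ Γ ∧ ∃ y ∈ g '' P, dist x y ≤ R}.Finite := by
  refine (finite_setOf_dist_le hΓ hP x (v 0) (R + maxVertexDist v)).subset ?_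
  rintro g ⟨hg, _, ⟨p, hp, rfl⟩, hle⟩
  refine ⟨hg, (dist_triangle x (g p) _).trans (add_le_add hle ?_)⟩
  rw [g.isometry.dist_eq]
  exact hP.polygon.dist_le_maxVertexDist hp (hP.polygon.vertex_mem 0)

/-- A geodesic segment of length less than `minGap v` which avoids the vertices of the tessellation
ends in a tile of the star of the tile in which it starts: all sides that it crosses have a common
end, or it crosses only one. -/
lemma mem_neighborMaps_of_line (hΓ : IsFuchsian Γ) (hP : IsFundamentalPolygon Γ P v) {c : ℝ → ℍ}
    (hc : Isometry c) {L : ℝ} (hL0 : 0 ≤ L) (hL : L < minGap v) (hc0 : c 0 ∈ P)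
    {g₀ : ℍ ≃ᵢ ℍ} (hg₀ : g₀ ∈ Γ) (hcL : c L ∈ g₀ '' interior P)
    (hav : ∀ g ∈ Γ, ∀ b, 0 ≤ b → b ≤ L → c b ∈ g '' P → ∀ t i, c t ≠ g (v i)) :
    g₀ ∈ neighborMaps Γ v := by
  by_cases h1 : g₀ = 1
  · exact ⟨hg₀, Or.inl h1⟩
  by_contra hT
  have himg1 : ∀ A : Set ℍ, (1 : ℍ ≃ᵢ ℍ) '' A = A := fun A => image_id A
  -- the tile entered when `P` is left
  have hne : {g | Reached Γ P v c L g}.Nonempty := by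
    have hc0' : c 0 ∈ (1 : ℍ ≃ᵢ ℍ) '' P := by rwa [himg1]
    obtain ⟨t, ht0, -, -, -, i, j, g, hg, hti, hside, hb⟩ := hP.exists_next hc hg₀ hcL Γ.one_mem
      (Ne.symm h1) (hav 1 Γ.one_mem 0 le_rfl hL0 hc0') hL0 hc0'
    exact ⟨g, hg, j, t, ht0, hside ▸ hti, hb, Or.inl ⟨i, by rw [hside, himg1]⟩⟩
  have hfin : {g | Reached Γ P v c L g}.Finite := by
    refine (finite_setOf_meets_closedBall hΓ hP (c 0) L).subset ?_
    rintro g ⟨hg, j, b, hb0, -, ⟨b', hb', hb'L, hmem⟩, -⟩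
    refine ⟨hg, c b', hmem, ?_⟩
    rw [hc.dist_eq, Real.dist_eq, zero_sub, abs_neg, abs_of_nonneg (by linarith)]
    exact hb'L
  have hbdd : ∀ g : ℍ ≃ᵢ ℍ, BddAbove (c ⁻¹' (g '' P)) := fun g =>
    (hc.isClosedEmbedding.isCompact_preimage (hP.polygon.isCompact.image g.continuous)).bddAbove
  -- consider the reached tile that is left last
  obtain ⟨g, hgR, hmax⟩ := exists_max_image _ (fun g : ℍ ≃ᵢ ℍ => sSup (c ⁻¹' (g '' P))) hfin hne
  have hgg₀ : g ≠ g₀ := fun e => hT (e ▸ Reached.mem_neighborMaps hgR)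
  obtain ⟨hg, j, b, hb0, hbj, ⟨b', hbb', hb'L, hb'P⟩, hcase⟩ := hgR
  have havg := hav g hg b' (by linarith) hb'L hb'P
  obtain ⟨t, hb't, htL, htP, hexit, i₁, j₁, g', hg', hti, hside, b₂, hb₂, hb₂L, hb₂P⟩ :=
    hP.exists_next hc hg₀ hcL hg hgg₀ havg hb'L hb'P
  have hbt : b < t := hbb'.trans_le hb't
  suffices hR : Reached Γ P v c L g' by
    have h2 : t = sSup (c ⁻¹' (g '' P)) :=
      (IsGreatest.csSup_eq (s := c ⁻¹' (g '' P))
        ⟨htP, fun s hs => not_lt.1 fun h => hexit s h hs⟩).symm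
    have h3 : b₂ ≤ sSup (c ⁻¹' (g' '' P)) := le_csSup (hbdd g') hb₂P
    have h4 := hmax g' hR
    simp only [← h2] at h4
    linarith
  -- the exit side `i₁` differs from the entry side `j` and is adjacent to it
  have hij : j ≠ i₁ := by
    rintro rfl
    rw [polySide, image_hypSegment] at hbj hti
    exact hbt.ne (eq_of_mem_hypSegment_of_line hc (g.injective.ne (hP.polygon.vertex_ne j))
      (fun s => havg s j) hbj hti)
  have hadj : AdjacentSides j i₁ := by
    by_contra hna
    obtain ⟨p, hp, hpb⟩ := hbj
    obtain ⟨q, hq, hqt⟩ := hti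
    have := minGap_le_dist ⟨hij, hna⟩ hp hq
    rw [← g.isometry.dist_eq, hpb, hqt, hc.dist_eq, Real.dist_eq, abs_sub_comm,
      abs_of_pos (by linarith)] at this
    linarith
  obtain ⟨l, hl⟩ := exists_isCorner hadj
  suffices hi₀ : ∃ i₀, g (v l) = v i₀ by
    obtain ⟨i₀, hi₀⟩ := hi₀
    exact ⟨hg', j₁, t, by linarith, hside ▸ hti, ⟨b₂, hb₂, hb₂L, hb₂P⟩,
      Or.inr ⟨g, hg, j, i₁, l, i₀, b, hb0, hbt, hl.symm, hside.symm, hbj, hi₀⟩⟩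
  rcases hcase with ⟨i, hi⟩ | ⟨σ, hσ, i, i', k, i₀, a, ha0, hab, hk, hσg, hca, hσk⟩
  · have hi' : g '' polySide v j = (1 : ℍ ≃ᵢ ℍ) '' polySide v i := by rw [hi, himg1]
    rcases hl.eq_or_eq with rfl | rfl <;> rcases image_polySide_eq hi' with ⟨e1, e2⟩ | ⟨e1, e2⟩
    · exact ⟨i, e1⟩
    · exact ⟨i + 1, e1⟩
    · exact ⟨i + 1, e2⟩
    · exact ⟨i, e2⟩
  · -- otherwise the entry side of `g P` would be crossed from one of its ends to the other
    refine ⟨i₀, ?_⟩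
    rw [← hσk]
    by_contra hne'
    have := minGap_le_of_corners hP.polygon hc hk hl hσg hne' hab hbt hca hbj hti
    linarith

/-- Tiles at distance less than `minGap v` have a common vertex or a common side. -/
lemma mem_neighborMaps_of_dist_lt (hΓ : IsFuchsian Γ) (hP : IsFundamentalPolygon Γ P v)
    {g : ℍ ≃ᵢ ℍ} (hg : g ∈ Γ) {x y : ℍ} (hx : x ∈ P) (hy : y ∈ g '' P)
    (hxy : dist x y < minGap v) : g ∈ neighborMaps Γ v := by
  have hclos := hP.polygon.convex.subset_closure_interior hP.polygon.interior_nonempty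
  have hclos' := (hP.polygon.convex.image g).subset_closure_interior
    (by rw [interior_image]; exact hP.polygon.interior_nonempty.image _)
  -- replace both points by interior points in general position
  set ε := (minGap v - dist x y) / 2 with hε
  have hε0 : 0 < ε := by rw [hε]; linarith
  obtain ⟨x', hx', hxx'⟩ := Metric.mem_closure_iff.1 (hclos hx) ε hε0
  obtain ⟨y₁, hy₁, hyy₁⟩ := Metric.mem_closure_iff.1 (hclos' hy) ε hε0
  set U := Metric.ball x' (minGap v) ∩ interior (g '' P) with hU
  have hUne : U.Nonempty := by
    refine ⟨y₁, ?_, hy₁⟩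
    rw [Metric.mem_ball, dist_comm]
    have h1 := dist_triangle4 x' x y y₁
    rw [dist_comm x' x] at h1
    linarith
  set F := (fun q : (ℍ ≃ᵢ ℍ) × Fin N => q.1 (v q.2)) ''
    ({h | h ∈ Γ ∧ ∃ y ∈ h '' P, dist x' y ≤ minGap v} ×ˢ univ) with hF
  have hFfin : F.Finite :=
    ((finite_setOf_meets_closedBall hΓ hP x' (minGap v)).prod finite_univ).image _
  have himg1 : ∀ A : Set ℍ, (1 : ℍ ≃ᵢ ℍ) '' A = A := fun A => image_id A
  have hxF : x' ∉ F := by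
    rintro ⟨⟨h, i⟩, ⟨⟨hh, -⟩, -⟩, e⟩
    simp only at e
    have h1 : (1 : ℍ ≃ᵢ ℍ) = h := hP.eq_of_mem_interior Γ.one_mem hh (x := x')
      (by rwa [himg1]) ⟨_, hP.polygon.vertex_mem i, e⟩
    rw [← h1] at e
    have hfr : x' ∈ frontier P := by
      rw [hP.polygon.frontier_eq, ← e]
      exact mem_iUnion.2 ⟨i, left_mem_hypSegment _ _⟩
    exact hfr.2 hx'
  obtain ⟨y', ⟨hy'b, hy'i⟩, hy'F⟩ := exists_mem_forall_det3_ne_zero hFfin hxF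
    (Metric.isOpen_ball.inter isOpen_interior) hUne
  rw [interior_image] at hy'i
  rcases eq_or_ne x' y' with rfl | hne
  · have h1 : g = 1 := hP.eq_of_mem_interior hg Γ.one_mem hy'i
      (by rw [himg1]; exact interior_subset hx')
    exact ⟨hg, Or.inl h1⟩
  obtain ⟨c, hc, hc0, hcL⟩ := exists_line hne
  rw [Metric.mem_ball, dist_comm] at hy'b
  refine mem_neighborMaps_of_line hΓ hP hc dist_nonneg hy'b (by rw [hc0]; exact interior_subset hx')
    hg (by rwa [hcL]) ?_
  intro h hh b hb0 hbL hbP t i e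
  refine hy'F (h (v i)) ⟨(h, i), ⟨⟨hh, c b, hbP, ?_⟩, mem_univ _⟩, rfl⟩ ?_
  · rw [← hc0, hc.dist_eq, Real.dist_eq, zero_sub, abs_neg, abs_of_nonneg hb0]
    linarith
  · rw [← e, ← hcL, ← hc0]
    exact det3_line_eq_zero hc _ _ _

/-! ### Distances on the quotient surface -/

lemma neighborMaps_pow_subset (k : ℕ) : neighborMaps Γ v ^ k ⊆ (Γ : Set (ℍ ≃ᵢ ℍ)) := by
  induction k with
  | zero => simp [Γ.one_mem]
  | succ k ih =>
    rw [pow_succ]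
    rintro _ ⟨a, ha, b, hb, rfl⟩
    exact Γ.mul_mem (ih ha) hb.1

lemma neighborMaps_finite (hΓ : IsFuchsian Γ) (hP : IsFundamentalPolygon Γ P v) :
    (neighborMaps Γ v).Finite := by
  refine (finite_setOf_meets_closedBall hΓ hP (v 0) (maxVertexDist v)).subset ?_
  rintro γ ⟨hγ, h⟩
  refine ⟨hγ, ?_⟩
  have hv := hP.polygon.vertex_mem
  have key : ∀ i j, γ (v j) ∈ polySide v i → ∃ y ∈ γ '' P, dist (v 0) y ≤ maxVertexDist v :=
    fun i j h => ⟨_, ⟨_, hv j, rfl⟩,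
      hP.polygon.dist_le_maxVertexDist (hv 0) (hP.polygon.side_subset i h)⟩
  rcases h with rfl | ⟨i, j, h⟩ | ⟨i, j, h⟩
  · exact key 0 0 (left_mem_hypSegment _ _)
  · exact key i j (h ▸ ⟨v j, left_mem_hypSegment _ _, rfl⟩)
  · exact key i j (h ▸ left_mem_hypSegment _ _)

lemma neighborMaps_pow_finite (hΓ : IsFuchsian Γ) (hP : IsFundamentalPolygon Γ P v) (k : ℕ) :
    (neighborMaps Γ v ^ k).Finite := by
  induction k with
  | zero => simp
  | succ k ih =>
    rw [pow_succ]
    exact ih.mul (neighborMaps_finite hΓ hP)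

/-- A chain of `n + 1` steps shorter than `minGap v` leads to a tile given by a product of `n + 1`
neighbor maps. -/
lemma mem_pow_of_chain (hΓ : IsFuchsian Γ) (hP : IsFundamentalPolygon Γ P v) {xs : ℕ → ℍ}
    (h0 : xs 0 ∈ P) (hstep : ∀ i, dist (xs i) (xs (i + 1)) < minGap v) (n : ℕ) :
    ∀ g ∈ Γ, xs (n + 1) ∈ g '' P → g ∈ neighborMaps Γ v ^ (n + 1) := by
  induction n with
  | zero =>
    intro g hg hx
    rw [zero_add, pow_one]
    exact mem_neighborMaps_of_dist_lt hΓ hP hg h0 hx (hstep 0)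
  | succ n ih =>
    intro g hg hx
    obtain ⟨h, hh, hxh⟩ := hP.cover (xs (n + 1))
    rw [pow_succ]
    refine ⟨h, ih h hh hxh, h⁻¹ * g, ?_, mul_inv_cancel_left h g⟩
    obtain ⟨p, hp, hpx⟩ := hxh
    obtain ⟨q, hq, hqx⟩ := hx
    refine mem_neighborMaps_of_dist_lt hΓ hP (Γ.mul_mem (Γ.inv_mem hh) hg) hp
      ⟨q, hq, rfl⟩ ?_
    rw [← h.isometry.dist_eq, IsometryEquiv.mul_apply, IsometryEquiv.apply_inv_self, hpx, hqx]
    exact hstep (n + 1)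

lemma mem_pow_of_dist_lt (hΓ : IsFuchsian Γ) (hP : IsFundamentalPolygon Γ P v) {z y : ℍ}
    (hz : z ∈ P) {g : ℍ ≃ᵢ ℍ} (hg : g ∈ Γ) (hy : y ∈ g '' P) {n : ℕ}
    (hlt : dist z y < (n + 1 : ℕ) * minGap v) : g ∈ neighborMaps Γ v ^ (n + 1) := by
  have hm := minGap_pos hP.polygon
  have hn : (0 : ℝ) < (n + 1 : ℕ) := by positivity
  rcases eq_or_ne z y with rfl | hne
  · exact mem_pow_of_chain hΓ hP (xs := fun _ => z) hz (by simpa using hm) n g hg hy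
  obtain ⟨c, hc, hc0, hcL⟩ := exists_line hne
  refine mem_pow_of_chain hΓ hP (xs := fun i => c (i * (dist z y / (n + 1 : ℕ))))
    (by simpa [hc0] using hz) (fun i => ?_) n g hg ?_
  · rw [hc.dist_eq, Real.dist_eq, abs_sub_comm, Nat.cast_succ i, ← sub_mul, add_sub_cancel_left,
      one_mul, abs_of_nonneg (by positivity), div_lt_iff₀ hn]
    linarith
  · rw [mul_div_cancel₀ _ hn.ne', hcL]
    exact hy

/-- The distance on the quotient surface is attained. -/
lemma exists_surfaceDist_eq (hΓ : IsFuchsian Γ) (hP : IsFundamentalPolygon Γ P v) (z w : ℍ) :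
    ∃ γ ∈ Γ, surfaceDist Γ z w = dist z (γ w) ∧ ∀ γ' ∈ Γ, dist z (γ w) ≤ dist z (γ' w) := by
  obtain ⟨γ, ⟨hγ, hle⟩, hmin⟩ := exists_min_image _ (fun γ : ℍ ≃ᵢ ℍ => dist z (γ w))
    (finite_setOf_dist_le hΓ hP z w (dist z w)) ⟨1, Γ.one_mem, le_rfl⟩
  have hmin' : ∀ γ' ∈ Γ, dist z (γ w) ≤ dist z (γ' w) := by
    intro γ' hγ'
    rcases le_total (dist z (γ' w)) (dist z w) with h | h
    · exact hmin γ' ⟨hγ', h⟩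
    · exact hle.trans h
  refine ⟨γ, hγ, le_antisymm ?_ ?_, hmin'⟩
  · exact ciInf_le (f := fun p : Γ × Γ => dist ((p.1 : ℍ ≃ᵢ ℍ) z) ((p.2 : ℍ ≃ᵢ ℍ) w))
      ⟨0, by rintro _ ⟨p, rfl⟩; exact dist_nonneg⟩ (1, ⟨γ, hγ⟩)
  · refine le_ciInf fun p => ?_
    have h := hmin' ((p.1 : ℍ ≃ᵢ ℍ)⁻¹ * p.2) (Γ.mul_mem (Γ.inv_mem p.1.2) p.2.2)
    rwa [IsometryEquiv.mul_apply, ← (p.1 : ℍ ≃ᵢ ℍ).isometry.dist_eq z ((p.1 : ℍ ≃ᵢ ℍ)⁻¹ _),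
      IsometryEquiv.apply_inv_self] at h

end Chain

end HypTess

theorem mainTheorem1 {N : ℕ} [NeZero N] (Γ : Subgroup (ℍ ≃ᵢ ℍ)) (hΓ : IsFuchsian Γ)
    (P : Set ℍ) (v : Fin N → ℍ) (hP : IsFundamentalPolygon Γ P v) :
    0 < minGap v ∧
    (neighborMaps Γ v ^ kStar v).Finite ∧
    DistanceFormula Γ P v (kStar v) ∧
    ∃ kmin : ℕ, IsLeast {k : ℕ | 0 < k ∧ DistanceFormula Γ P v k} kmin ∧ kmin ≤ kStar v := by
  have hm := HypTess.minGap_pos hP.polygon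
  have hD : 0 ≤ maxVertexDist v := dist_nonneg.trans
    (hP.polygon.dist_le_maxVertexDist (hP.polygon.vertex_mem 0) (hP.polygon.vertex_mem 0))
  have hk : 0 < kStar v := Nat.floor_pos.2 (by
    have : 0 ≤ maxVertexDist v / minGap v := by positivity
    linarith)
  have hformula : DistanceFormula Γ P v (kStar v) := by
    intro z hz w hw
    obtain ⟨γ, hγ, hdist, hmin⟩ := HypTess.exists_surfaceDist_eq hΓ hP z w
    rw [hdist]
    refine ⟨⟨γ, ?_, rfl⟩, ?_⟩
    · obtain ⟨n, hn⟩ := Nat.exists_eq_succ_of_ne_zero hk.ne'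
      rw [Nat.succ_eq_add_one] at hn
      rw [hn]
      refine HypTess.mem_pow_of_dist_lt hΓ hP hz hγ ⟨w, hw, rfl⟩ ?_
      rw [← hn, ← div_lt_iff₀ hm]
      have h1 : dist z (γ w) ≤ maxVertexDist v :=
        (hmin 1 Γ.one_mem).trans (hP.polygon.dist_le_maxVertexDist hz hw)
      have h2 : dist z (γ w) / minGap v ≤ maxVertexDist v / minGap v := by gcongr
      -- the floor of `1 + q` is greater than `q`, so each of the `kStar v` pieces is short enough
      have h3 := Nat.lt_floor_add_one (1 + maxVertexDist v / minGap v)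
      change _ < (kStar v : ℝ) + 1 at h3
      linarith
    · rintro _ ⟨γ', hγ', rfl⟩
      exact hmin γ' (HypTess.neighborMaps_pow_subset _ hγ')
  have hex : ∃ k, 0 < k ∧ DistanceFormula Γ P v k := ⟨kStar v, hk, hformula⟩
  classical
  exact ⟨hm, HypTess.neighborMaps_pow_finite hΓ hP _, hformula, Nat.find hex,
    ⟨Nat.find_spec hex, fun k hk => Nat.find_min' hex hk⟩, Nat.find_min' hex ⟨hk, hformula⟩⟩
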